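/- Let $\Lambda=[a,b]\subset\mathbb R$ be a fixed finite interval of length $|\Lambda|=b-a>0$, let $\beta>0$ be fixed, and let $V:\Lambda\to\mathbb R$ be a bounded measurable function. Let $h=-\frac{d^2}{dx^2}+V$ in $L^2(\Lambda)$ with Dirichlet boundary conditions (domain $H^2(\Lambda)\cap H^1_0(\Lambda)$). The eigenvalues of $h$ are simple and form an infinite strictly increasing sequence $\varepsilon_1^{(V)}<\varepsilon_2^{(V)}<\cdots$, and for every $\mu\in\mathbb R$ the grand canonical partition function $$\Xi_\mu^{(V)}(\Lambda)=\prod_{k=1}^\infty\Bigl(1+z\,e^{-\beta\varepsilon_k^{(V)}}\Bigr),\qquad z=e^{\mu\beta},$$ is a convergent product. As $\mu\to\infty$, $$\frac{\ln\Xi_\mu^{(V)}(\Lambda)}{\ln\Xi_\mu^{(0)}(\Lambda)}\to 1 .$$ Moreover, both $\ln\Xi_\mu^{(V)}(\Lambda)$ and $\ln\Xi_\mu^{(0)}(\Lambda)$ are asymptotically equivalent to $\frac{2}{3}\,\beta\,\frac{|\Lambda|}{\pi}\,\mu^{3/2}$ as $\mu\to\infty$. -/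

import Mathlib

open MeasureTheory Filter Topology Asymptotics
open scoped ENNReal

noncomputable section

namespace FermiGas

/-- The complex Hilbert space `L²(Λ)` of the interval `Λ = [a, b]`. -/
abbrev L2 (a b : ℝ) : Type :=
  Lp ℂ 2 ((volume : Measure ℝ).restrict (Set.Icc a b))

/-- `HasDirichletSecondDeriv f w`: the class `f` has a representative `u` which is `C¹` on `[a, b]`,
whose derivative `v` is absolutely continuous with a.e. derivative `w ∈ L²`, and which satisfies the
Dirichlet conditions `u a = u b = 0`. In other words `f ∈ H²(Λ) ∩ H¹₀(Λ)` and `f'' = w`. -/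
def HasDirichletSecondDeriv {a b : ℝ} (f w : L2 a b) : Prop :=
  ∃ u v : ℝ → ℂ,
    (∀ x ∈ Set.Icc a b, HasDerivWithinAt u (v x) (Set.Icc a b) x) ∧
    (∀ x ∈ Set.Icc a b, v x = v a + ∫ t in a..x, w t) ∧
    u a = 0 ∧ u b = 0 ∧
    ∀ᵐ x ∂((volume : Measure ℝ).restrict (Set.Icc a b)), f x = u x

theorem intervalIntegrable_L2 {a b x : ℝ} (w : L2 a b) (hx : x ∈ Set.Icc a b) :
    IntervalIntegrable w volume a x := by
  have h1 : IntegrableOn w (Set.Icc a b) volume :=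
    (Lp.memLp w).integrable (by norm_num)
  rw [intervalIntegrable_iff_integrableOn_Ioc_of_le hx.1]
  exact h1.mono_set fun y hy => ⟨hy.1.le, hy.2.trans hx.2⟩

theorem intervalIntegral_congr_L2 {a b x : ℝ} (hx : x ∈ Set.Icc a b) {f g : ℝ → ℂ}
    (h : f =ᵐ[(volume : Measure ℝ).restrict (Set.Icc a b)] g) :
    ∫ t in a..x, f t = ∫ t in a..x, g t := by
  apply intervalIntegral.integral_congr_ae_restrict
  rw [Set.uIoc_of_le hx.1]
  have hs : Set.Ioc a x ⊆ Set.Icc a b := fun y hy => ⟨hy.1.le, hy.2.trans hx.2⟩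
  exact ae_restrict_of_ae_restrict_of_subset hs h

theorem HasDirichletSecondDeriv.zero {a b : ℝ} : HasDirichletSecondDeriv (0 : L2 a b) 0 := by
  refine ⟨0, 0, fun x _ => hasDerivWithinAt_const _ _ _, fun x hx => ?_, rfl, rfl, ?_⟩
  · have h : ∫ t in a..x, (0 : L2 a b) t = ∫ t in a..x, (0 : ℂ) := 
      intervalIntegral_congr_L2 hx (Lp.coeFn_zero _ _ _)
    rw [h]
    simp
  · exact Lp.coeFn_zero _ _ _

theorem HasDirichletSecondDeriv.add {a b : ℝ} {f w f' w' : L2 a b}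
    (h : HasDirichletSecondDeriv f w) (h' : HasDirichletSecondDeriv f' w') :
    HasDirichletSecondDeriv (f + f') (w + w') := by
  obtain ⟨u, v, h1, h2, h3, h4, h5⟩ := h
  obtain ⟨u', v', h1', h2', h3', h4', h5'⟩ := h'
  refine ⟨u + u', v + v', fun x hx => (h1 x hx).add (h1' x hx), fun x hx => ?_, by simp [h3, h3'],
    by simp [h4, h4'], ?_⟩
  · have h : ∫ t in a..x, (w + w' : L2 a b) t = ∫ t in a..x, (w t + w' t) := 
      intervalIntegral_congr_L2 hx (Lp.coeFn_add w w')
    rw [h, intervalIntegral.integral_add (intervalIntegrable_L2 w hx) (intervalIntegrable_L2 w' hx)]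
    simp only [Pi.add_apply, h2 x hx, h2' x hx]
    ring
  · filter_upwards [Lp.coeFn_add f f', h5, h5'] with x e1 e2 e3
    rw [e1, Pi.add_apply, Pi.add_apply, e2, e3]

theorem HasDirichletSecondDeriv.smul {a b : ℝ} {f w : L2 a b} (c : ℂ)
    (h : HasDirichletSecondDeriv f w) : HasDirichletSecondDeriv (c • f) (c • w) := by
  obtain ⟨u, v, h1, h2, h3, h4, h5⟩ := h
  refine ⟨c • u, c • v, fun x hx => (h1 x hx).const_smul c, fun x hx => ?_, by simp [h3],
    by simp [h4], ?_⟩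
  · have h : ∫ t in a..x, (c • w : L2 a b) t = ∫ t in a..x, c • w t := 
      intervalIntegral_congr_L2 hx (Lp.coeFn_smul c w)
    rw [h, intervalIntegral.integral_smul]
    simp only [Pi.smul_apply, h2 x hx, smul_eq_mul]
    ring
  · filter_upwards [Lp.coeFn_smul c f, h5] with x e1 e2
    rw [e1, Pi.smul_apply, Pi.smul_apply, e2]

/-- The second derivative is determined by the function. -/
theorem HasDirichletSecondDeriv.eq_zero {a b : ℝ} {w : L2 a b}
    (h : HasDirichletSecondDeriv 0 w) : w = 0 := by
  rw [Lp.eq_zero_iff_ae_eq_zero]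
  change ∀ᵐ x ∂((volume : Measure ℝ).restrict (Set.Icc a b)), w x = 0
  rcases le_or_gt b a with hab | hab
  · have : (volume : Measure ℝ).restrict (Set.Icc a b) = 0 := by
      rw [Measure.restrict_eq_zero, Real.volume_Icc]
      simpa using hab
    exact congrArg (fun m : Measure ℝ => m {x | ¬ w x = 0}) this
  obtain ⟨u, v, h1, h2, -, -, h5⟩ := h
  have hu : Set.EqOn u 0 (Set.Icc a b) := by
    apply Measure.eqOn_Icc_of_ae_eq (volume : Measure ℝ) hab.ne
    · filter_upwards [h5, Lp.coeFn_zero ℂ 2 ((volume : Measure ℝ).restrict (Set.Icc a b))]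
        with x e1 e2
      rw [← e1, e2]
    · exact fun x hx => (h1 x hx).continuousWithinAt
    · exact continuousOn_const
  have hv : ∀ x ∈ Set.Icc a b, v x = 0 := fun x hx =>
    (uniqueDiffOn_Icc hab x hx).eq_deriv _ (h1 x hx)
      ((hasDerivWithinAt_const x (Set.Icc a b) (0 : ℂ)).congr hu (hu hx))
  have hw : ∀ x ∈ Set.Icc a b, ∫ t in a..x, w t = 0 := fun x hx => by
    have := h2 x hx
    rw [hv x hx, hv a ⟨le_rfl, hab.le⟩, zero_add] at this
    exact this.symm
  have hd := (intervalIntegrable_L2 w ⟨hab.le, le_rfl⟩).ae_hasDerivAt_integral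
  rw [Set.uIcc_of_le hab.le] at hd
  have hI : ∀ᵐ x ∂((volume : Measure ℝ).restrict (Set.Icc a b)), x ∈ Set.Ioo a b := by
    have hm := ae_restrict_mem (μ := (volume : Measure ℝ)) (measurableSet_Ioo (a := a) (b := b))
    rwa [Measure.restrict_congr_set Ioo_ae_eq_Icc] at hm
  filter_upwards [ae_restrict_of_ae hd, hI] with x hx hxm
  have e1 := hx ⟨hxm.1.le, hxm.2.le⟩ a ⟨le_rfl, hab.le⟩
  have e2 : HasDerivAt (fun x => ∫ t in a..x, w t) 0 x :=
    (hasDerivAt_const x (0 : ℂ)).congr_of_eventuallyEq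
      (by filter_upwards [Icc_mem_nhds hxm.1 hxm.2] with y hy using hw y hy)
  exact e1.unique e2

/-- The graph of `h = -d²/dx² + V` on the domain `H²(Λ) ∩ H¹₀(Λ)`: the pairs `(f, g)` in
`L²(Λ) × L²(Λ)` with `g = -f'' + V f`. -/
def hamiltonianGraph (a b : ℝ) (V : ℝ → ℝ) : Submodule ℂ (L2 a b × L2 a b) where
  carrier := {p | ∃ w : L2 a b, HasDirichletSecondDeriv p.1 w ∧
    ∀ᵐ x ∂((volume : Measure ℝ).restrict (Set.Icc a b)), p.2 x = -w x + (V x : ℂ) * p.1 x}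
  zero_mem' := by
    refine ⟨0, HasDirichletSecondDeriv.zero, ?_⟩
    filter_upwards [Lp.coeFn_zero ℂ 2 ((volume : Measure ℝ).restrict (Set.Icc a b))] with x hx
    simp only [Prod.fst_zero, Prod.snd_zero]
    rw [hx]
    simp
  add_mem' := by
    rintro ⟨f, g⟩ ⟨f', g'⟩ ⟨w, h, e⟩ ⟨w', h', e'⟩
    refine ⟨w + w', h.add h', ?_⟩
    filter_upwards [e, e', Lp.coeFn_add f f', Lp.coeFn_add g g', Lp.coeFn_add w w']
      with x e1 e2 e3 e4 e5
    simp only [Prod.mk_add_mk, Pi.add_apply] at e1 e2 e3 e4 e5 ⊢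
    rw [e3, e4, e5, e1, e2]
    ring
  smul_mem' := by
    rintro c ⟨f, g⟩ ⟨w, h, e⟩
    refine ⟨c • w, h.smul c, ?_⟩
    filter_upwards [e, Lp.coeFn_smul c f, Lp.coeFn_smul c g, Lp.coeFn_smul c w] with x e1 e3 e4 e5
    simp only [Prod.smul_mk, Pi.smul_apply, smul_eq_mul] at e1 e3 e4 e5 ⊢
    rw [e3, e4, e5, e1]
    ring

/-- The one-particle Hamiltonian `h = -d²/dx² + V` in `L²(Λ)`, `Λ = [a, b]`, with Dirichlet boundary
conditions, as an unbounded operator. -/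
def hamiltonian (a b : ℝ) (V : ℝ → ℝ) : L2 a b →ₗ.[ℂ] L2 a b :=
  (hamiltonianGraph a b V).toLinearPMap

/-- `hamiltonianGraph` really is the graph of `hamiltonian`. -/
theorem hamiltonian_graph (a b : ℝ) (V : ℝ → ℝ) :
    (hamiltonian a b V).graph = hamiltonianGraph a b V := by
  apply Submodule.toLinearPMap_graph_eq
  rintro ⟨f, g⟩ ⟨w, h, e⟩ hf
  simp only at hf h e ⊢
  subst hf
  have hw := h.eq_zero
  subst hw
  rw [Lp.eq_zero_iff_ae_eq_zero]
  filter_upwards [e, Lp.coeFn_zero ℂ 2 ((volume : Measure ℝ).restrict (Set.Icc a b))] with x e1 e2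
  rw [e1, e2]
  simp

/-- The eigenspace `{f ∈ D(h) : h f = E f}`. -/
def eigenspace (a b : ℝ) (V : ℝ → ℝ) (E : ℝ) : Submodule ℂ (L2 a b) where
  carrier := {f | (f, (E : ℂ) • f) ∈ (hamiltonian a b V).graph}
  zero_mem' := by
    change ((0 : L2 a b), (E : ℂ) • (0 : L2 a b)) ∈ (hamiltonian a b V).graph
    rw [smul_zero]
    exact (hamiltonian a b V).graph.zero_mem
  add_mem' := by
    intro f g hf hg
    change (f + g, (E : ℂ) • (f + g)) ∈ (hamiltonian a b V).graph
    rw [smul_add]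
    exact (hamiltonian a b V).graph.add_mem hf hg
  smul_mem' := by
    intro c f hf
    change (c • f, (E : ℂ) • (c • f)) ∈ (hamiltonian a b V).graph
    rw [smul_comm (E : ℂ) c f]
    exact (hamiltonian a b V).graph.smul_mem c hf

/-- The set of eigenvalues of `h` (real numbers, since `V` is real and `h` is symmetric). -/
def eigenvalueSet (a b : ℝ) (V : ℝ → ℝ) : Set ℝ :=
  {E | eigenspace a b V E ≠ ⊥}

/-- The eigenvalues in increasing order: `energy a b V k` is the `(k+1)`-st smallest eigenvalue,
i.e. the least `t` such that at least `k + 1` eigenvalues are `≤ t`. -/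
def energy (a b : ℝ) (V : ℝ → ℝ) (k : ℕ) : ℝ :=
  sInf {t : ℝ | ((k + 1 : ℕ) : ℕ∞) ≤ (eigenvalueSet a b V ∩ Set.Iic t).encard}

/-- The `k`-th factor `1 + z e^{-β ε_k}`, `z = e^{μ β}`, of the grand canonical partition
function. -/
def grandFactor (a b β : ℝ) (V : ℝ → ℝ) (μ : ℝ) (k : ℕ) : ℝ :=
  1 + Real.exp (μ * β) * Real.exp (-β * energy a b V k)

/-- The grand canonical partition function `Ξ_μ^{(V)}(Λ) = ∏_k (1 + z e^{-β ε_k})`. -/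
def grandPartition (a b β : ℝ) (V : ℝ → ℝ) (μ : ℝ) : ℝ :=
  ∏' k : ℕ, grandFactor a b β V μ k

end FermiGas

end

/-! The proof is a Weyl law obtained by Prüfer's method. In polar coordinates `u = r sin θ`, `u' = r
cos θ`, the equation `-u'' = (E - V) u`, `u a = 0` becomes a scalar equation for the angle, `θ' =
cos² θ + (E - V) sin² θ`, which makes sense almost everywhere for bounded measurable `V`. The radius
never vanishes, so `E` is an eigenvalue iff `θ_E(b)` is a multiple of `π` (`mem_eigenvalueSet_iff`),
and the solution is unique up to a factor (`eigenfunction_ae_eq`), which gives simplicity.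

The map `E ↦ θ_E(b)` is positive, continuous and strictly increasing, so each value `(k + 1) π` is
attained at exactly one energy. Comparison with the explicit angles for constant coefficients, where
`|V| ≤ M`, traps this energy between `(π/(b-a) (k + 1/2))² - M` and `(π/(b-a) (k + 3/2))² + M`
(`exists_eigenvalue_enumeration`).

These bounds alone determine the asymptotics. With `c = π/(b-a)`, `log (1 + e^x)` is close to the
positive part of `x`, so `log Ξ` is to leading order the sum of `β (μ - c² k²)` over `k < √μ / c`,
that is `(2/3) β μ^(3/2) / c`. The constant `M` and the index shifts only affect lower orders
(`tsum_log_ge`, `tsum_log_le`, `tendsto_tsum_log_div`), so `V` and `0` give the same limit. -/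

namespace FermiGas

/-! ### Calculus of absolutely continuous functions. -/

/-- `F` is absolutely continuous on `[a, b]` with derivative `f` almost everywhere. -/
structure IsPrim (a b : ℝ) (F f : ℝ → ℝ) : Prop where
  ac : AbsolutelyContinuousOnInterval F a b
  deriv : ∀ᵐ x, x ∈ Set.Ioo a b → HasDerivAt F (f x) x

theorem absolutelyContinuousOnInterval_congr {a b : ℝ} {F G : ℝ → ℝ}
    (hF : AbsolutelyContinuousOnInterval F a b) (h : Set.EqOn F G (Set.uIcc a b)) :
    AbsolutelyContinuousOnInterval G a b := by
  rw [absolutelyContinuousOnInterval_iff] at hF ⊢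
  intro ε hε
  obtain ⟨δ, hδ, H⟩ := hF ε hε
  refine ⟨δ, hδ, fun E hE hs => ?_⟩
  refine lt_of_eq_of_lt (Finset.sum_congr rfl fun i hi => ?_) (H E hE hs)
  rw [h (hE.1 i hi).1, h (hE.1 i hi).2]

theorem absolutelyContinuousOnInterval_lipschitz_comp {a b : ℝ} {F φ : ℝ → ℝ} {K : NNReal}
    {s : Set ℝ} (hφ : LipschitzOnWith K φ s) (hF : AbsolutelyContinuousOnInterval F a b)
    (hs : Set.MapsTo F (Set.uIcc a b) s) : AbsolutelyContinuousOnInterval (φ ∘ F) a b := by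
  rw [absolutelyContinuousOnInterval_iff] at hF ⊢
  intro ε hε
  obtain ⟨δ, hδ, H⟩ := hF (ε / (K + 1)) (by positivity)
  refine ⟨δ, hδ, fun E hE hd => ?_⟩
  have h1 := H E hE hd
  rw [lt_div_iff₀ (by positivity)] at h1
  refine lt_of_le_of_lt ?_ h1
  rw [Finset.sum_mul]
  refine Finset.sum_le_sum fun i hi => ?_
  have h2 := hφ.dist_le_mul _ (hs (hE.1 i hi).1) _ (hs (hE.1 i hi).2)
  have h3 : 0 ≤ dist (F (E.2 i).1) (F (E.2 i).2) := dist_nonneg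
  simp only [Function.comp_apply]
  linarith

theorem ae_mem_Icc_imp_mem_Ioo (a b : ℝ) : ∀ᵐ x : ℝ, x ∈ Set.Icc a b → x ∈ Set.Ioo a b := by
  filter_upwards [(Ioo_ae_eq_Icc (μ := (volume : Measure ℝ)) (a := a) (b := b)).mem_iff]
    with x hx h using hx.2 h

namespace IsPrim

variable {a b : ℝ} {F G f g : ℝ → ℝ}

theorem congr_deriv (h : IsPrim a b F f) (hfg : ∀ᵐ x, x ∈ Set.Ioo a b → f x = g x) :
    IsPrim a b F g :=
  ⟨h.ac, by filter_upwards [h.deriv, hfg] with x h1 h2 hx using h2 hx ▸ h1 hx⟩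

theorem congr_deriv' (h : IsPrim a b F f) (hfg : ∀ x ∈ Set.Ioo a b, f x = g x) :
    IsPrim a b F g :=
  h.congr_deriv (ae_of_all _ hfg)

theorem continuousOn (hab : a ≤ b) (h : IsPrim a b F f) : ContinuousOn F (Set.Icc a b) := by
  have := h.ac.continuousOn
  rwa [Set.uIcc_of_le hab] at this

theorem add (hF : IsPrim a b F f) (hG : IsPrim a b G g) :
    IsPrim a b (fun x => F x + G x) (fun x => f x + g x) :=
  ⟨hF.ac.add hG.ac, by
    filter_upwards [hF.deriv, hG.deriv] with x h1 h2 hx using (h1 hx).add (h2 hx)⟩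

theorem sub (hF : IsPrim a b F f) (hG : IsPrim a b G g) :
    IsPrim a b (fun x => F x - G x) (fun x => f x - g x) :=
  ⟨hF.ac.sub hG.ac, by
    filter_upwards [hF.deriv, hG.deriv] with x h1 h2 hx using (h1 hx).sub (h2 hx)⟩

theorem mul (hF : IsPrim a b F f) (hG : IsPrim a b G g) :
    IsPrim a b (fun x => F x * G x) (fun x => f x * G x + F x * g x) :=
  ⟨hF.ac.mul hG.ac, by
    filter_upwards [hF.deriv, hG.deriv] with x h1 h2 hx using (h1 hx).mul (h2 hx)⟩

theorem comp (hab : a ≤ b) (hF : IsPrim a b F f) {φ φ' : ℝ → ℝ} (hφ : ContDiff ℝ 1 φ)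
    (hφ' : ∀ y, HasDerivAt φ (φ' y) y) :
    IsPrim a b (fun x => φ (F x)) (fun x => φ' (F x) * f x) := by
  -- `φ` need not be globally Lipschitz (`exp` is not); it is so on a compact interval containing
  -- the range of `F`.
  obtain ⟨C, hC⟩ := isCompact_Icc.exists_bound_of_continuousOn (hF.continuousOn hab)
  obtain ⟨K, hK⟩ := (hφ.contDiffOn (s := Set.Icc (-C) C)).exists_lipschitzOnWith (by decide)
    (convex_Icc _ _) isCompact_Icc
  refine ⟨absolutelyContinuousOnInterval_lipschitz_comp hK hF.ac fun x hx => ?_, ?_⟩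
  · rw [Set.uIcc_of_le hab] at hx
    exact abs_le.1 (hC x hx)
  · filter_upwards [hF.deriv] with x h1 hx using (hφ' (F x)).comp x (h1 hx)

theorem exp (hab : a ≤ b) (hF : IsPrim a b F f) :
    IsPrim a b (fun x => Real.exp (F x)) (fun x => Real.exp (F x) * f x) :=
  hF.comp hab Real.contDiff_exp Real.hasDerivAt_exp

theorem sin (hab : a ≤ b) (hF : IsPrim a b F f) :
    IsPrim a b (fun x => Real.sin (F x)) (fun x => Real.cos (F x) * f x) :=
  hF.comp hab Real.contDiff_sin Real.hasDerivAt_sin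

theorem cos (hab : a ≤ b) (hF : IsPrim a b F f) :
    IsPrim a b (fun x => Real.cos (F x)) (fun x => -Real.sin (F x) * f x) :=
  hF.comp hab Real.contDiff_cos Real.hasDerivAt_cos

theorem neg (hF : IsPrim a b F f) : IsPrim a b (fun x => -F x) (fun x => -f x) :=
  ⟨hF.ac.neg, by filter_upwards [hF.deriv] with x h1 hx using (h1 hx).neg⟩

theorem mono (hF : IsPrim a b F f) {c d : ℝ} (hab : a ≤ b) (hcd : c ≤ d) (hac : a ≤ c)
    (hdb : d ≤ b) : IsPrim c d F f :=
  ⟨hF.ac.mono (by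
    rw [Set.uIcc_of_le hab, Set.uIcc_of_le hcd]; exact Set.Icc_subset_Icc hac hdb), by
    filter_upwards [hF.deriv] with x h1 hx using h1 (Set.Ioo_subset_Ioo hac hdb hx)⟩

theorem integral_eq (hab : a ≤ b) (hF : IsPrim a b F f) {x : ℝ} (hx : x ∈ Set.Icc a b) :
    F x - F a = ∫ t in a..x, f t := by
  have h := hF.mono hab hx.1 le_rfl hx.2
  rw [← h.ac.integral_deriv_eq_sub]
  refine intervalIntegral.integral_congr_ae ?_
  filter_upwards [h.deriv, ae_mem_Icc_imp_mem_Ioo a x] with t h1 h2 ht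
  rw [Set.uIoc_of_le hx.1] at ht
  exact (h1 (h2 ⟨ht.1.le, ht.2⟩)).deriv

theorem of_integral (hab : a ≤ b) (hf : IntervalIntegrable f volume a b)
    (h : ∀ x ∈ Set.Icc a b, F x = F a + ∫ t in a..x, f t) : IsPrim a b F f := by
  constructor
  · have h1 := (hf.absolutelyContinuousOnInterval_intervalIntegral (c := a) (by simp)).add
      ((contDiff_const (c := F a) (n := 1)).contDiffOn.absolutelyContinuousOnInterval
        (a := a) (b := b))
    refine absolutelyContinuousOnInterval_congr h1 fun x hx => ?_
    rw [Set.uIcc_of_le hab] at hx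
    rw [h x hx, Pi.add_apply, add_comm]
  · filter_upwards [hf.ae_hasDerivAt_integral] with x h1 hx
    have hx' : x ∈ Set.Icc a b := Set.Ioo_subset_Icc_self hx
    rw [Set.uIcc_of_le hab] at h1
    refine ((h1 hx' a (Set.left_mem_Icc.2 hab)).const_add (F a)).congr_of_eventuallyEq ?_
    filter_upwards [Icc_mem_nhds hx.1 hx.2] with y hy using h y hy

theorem of_hasDerivAt (hF : ContDiff ℝ 1 F) (h : ∀ x, HasDerivAt F (f x) x) : IsPrim a b F f :=
  ⟨hF.contDiffOn.absolutelyContinuousOnInterval, ae_of_all _ fun x _ => h x⟩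

theorem intervalIntegrable (hab : a ≤ b) (hF : IsPrim a b F f) :
    IntervalIntegrable f volume a b := by
  refine hF.ac.intervalIntegrable_deriv.congr_ae ?_
  rw [Set.uIoc_of_le hab, Filter.EventuallyEq, ae_restrict_iff' measurableSet_Ioc]
  filter_upwards [hF.deriv, ae_mem_Icc_imp_mem_Ioo a b] with t h1 h2 ht
  exact (h1 (h2 ⟨ht.1.le, ht.2⟩)).deriv

theorem le_of_nonneg (hab : a ≤ b) (hF : IsPrim a b F f)
    (hf : ∀ᵐ x, x ∈ Set.Ioo a b → 0 ≤ f x) {x y : ℝ} (hx : a ≤ x) (hxy : x ≤ y) (hy : y ≤ b) :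
    F x ≤ F y := by
  have h := hF.mono hab hxy hx hy
  rw [← sub_nonneg, h.integral_eq hxy (Set.right_mem_Icc.2 hxy)]
  refine intervalIntegral.integral_nonneg_of_ae_restrict hxy ?_
  rw [Filter.EventuallyLE, ae_restrict_iff' measurableSet_Icc]
  filter_upwards [hf, ae_mem_Icc_imp_mem_Ioo x y] with t h1 h2 ht
  exact h1 (Set.Ioo_subset_Ioo hx hy (h2 ht))

theorem abs_sub_le (hab : a ≤ b) (hF : IsPrim a b F f) {B : ℝ}
    (hf : ∀ x ∈ Set.Ioo a b, |f x| ≤ B) {x : ℝ} (hx : x ∈ Set.Icc a b) :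
    |F x - F a| ≤ B * (x - a) := by
  rw [hF.integral_eq hab hx]
  have := intervalIntegral.norm_integral_le_of_norm_le_const_ae (f := f) (a := a) (b := x) (C := B) (by
    filter_upwards [ae_mem_Icc_imp_mem_Ioo a x] with t h2 ht
    rw [Set.uIoc_of_le hx.1] at ht
    exact hf t (Set.Ioo_subset_Ioo le_rfl hx.2 (h2 ⟨ht.1.le, ht.2⟩)))
  rwa [abs_of_nonneg (sub_nonneg.2 hx.1)] at this

theorem eq_of_deriv_zero (hab : a ≤ b) (hF : IsPrim a b F f)
    (hf : ∀ᵐ x, x ∈ Set.Ioo a b → f x = 0) {x : ℝ} (hx : x ∈ Set.Icc a b) : F x = F a := by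
  refine le_antisymm ?_ (hF.le_of_nonneg hab ?_ le_rfl hx.1 hx.2)
  · have := hF.neg.le_of_nonneg hab ?_ le_rfl hx.1 hx.2
    · linarith
    · filter_upwards [hf] with t h ht
      rw [h ht, neg_zero]
  · filter_upwards [hf] with t h ht
    rw [h ht]

end IsPrim

/-- An integrable function has a primitive vanishing at `a`. -/
theorem exists_isPrim {a b : ℝ} (hab : a ≤ b) {f : ℝ → ℝ} (hf : IntervalIntegrable f volume a b) :
    ∃ F : ℝ → ℝ, F a = 0 ∧ IsPrim a b F f :=
  ⟨fun x => ∫ t in a..x, f t, by simp, .of_integral hab hf fun x _ => by simp⟩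

theorem intervalIntegrable_of_bounded {a b : ℝ} (hab : a ≤ b) {f : ℝ → ℝ} {B : ℝ}
    (hm : AEStronglyMeasurable f (volume.restrict (Set.Icc a b)))
    (hB : ∀ x ∈ Set.Icc a b, |f x| ≤ B) :
    IntervalIntegrable f volume a b := by
  rw [intervalIntegrable_iff_integrableOn_Icc_of_le hab]
  exact Integrable.of_bound hm B ((ae_restrict_iff' measurableSet_Icc).2 (ae_of_all _ hB))

/-- Integrating factor: `d' = c d + s` gives `(d e^{-C})' = s e^{-C}`. -/
theorem IsPrim.integratingFactor {a b : ℝ} (hab : a ≤ b) {d c s C : ℝ → ℝ}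
    (hd : IsPrim a b d fun x => c x * d x + s x) (hC : IsPrim a b C c) :
    IsPrim a b (fun x => d x * Real.exp (-C x)) fun x => s x * Real.exp (-C x) :=
  (hd.mul (hC.neg.exp hab)).congr_deriv' fun x _ => by ring

/-! ### The Prüfer angle: existence, comparison, dependence on the coefficient. -/

/-- `θ` is the Prüfer angle of the problem `-u'' = q u`, `u a = 0`. -/
structure IsPrufer (a b : ℝ) (q θ : ℝ → ℝ) : Prop where
  zero : θ a = 0
  prim : IsPrim a b θ fun x => Real.cos (θ x) ^ 2 + q x * Real.sin (θ x) ^ 2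

theorem sin_sq_sub_sin_sq (x y : ℝ) :
    Real.sin x ^ 2 - Real.sin y ^ 2 = Real.sin (x - y) * Real.sin (x + y) := by
  rw [Real.sin_sub, Real.sin_add]
  linear_combination (Real.sin y ^ 2) * Real.sin_sq_add_cos_sq x -
    (Real.sin x ^ 2) * Real.sin_sq_add_cos_sq y

theorem pruferRate_eq (q y : ℝ) :
    Real.cos y ^ 2 + q * Real.sin y ^ 2 = 1 + (q - 1) * Real.sin y ^ 2 := by
  linear_combination Real.sin_sq_add_cos_sq y

theorem abs_pruferRate_le {q K : ℝ} (hq : |q| ≤ K) (y : ℝ) :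
    |Real.cos y ^ 2 + q * Real.sin y ^ 2| ≤ 1 + K := by
  have h1 := Real.sin_sq_le_one y
  have h2 := Real.cos_sq_le_one y
  have h3 := sq_nonneg (Real.sin y)
  have h4 := sq_nonneg (Real.cos y)
  rw [abs_le] at *
  constructor <;> nlinarith

theorem abs_pruferRate_sub_le {q K : ℝ} (hq : |q| ≤ K) (y z : ℝ) :
    |(Real.cos y ^ 2 + q * Real.sin y ^ 2) - (Real.cos z ^ 2 + q * Real.sin z ^ 2)| ≤
      (1 + K) * |y - z| := by
  rw [pruferRate_eq, pruferRate_eq, show 1 + (q - 1) * Real.sin y ^ 2 -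
    (1 + (q - 1) * Real.sin z ^ 2) = (q - 1) * (Real.sin y ^ 2 - Real.sin z ^ 2) by ring,
    sin_sq_sub_sin_sq, abs_mul, abs_mul]
  have h1 : |q - 1| ≤ 1 + K := (abs_sub q 1).trans (by rw [abs_one]; linarith)
  have h2 : |Real.sin (y - z)| ≤ |y - z| := Real.abs_sin_le_abs
  have h3 := Real.abs_sin_le_one (y + z)
  have h4 : |Real.sin (y - z)| * |Real.sin (y + z)| ≤ |y - z| * 1 := by gcongr
  rw [mul_one] at h4
  have h5 : 0 ≤ 1 + K := (abs_nonneg _).trans h1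
  gcongr

/-- The Prüfer equation with a bounded measurable coefficient is solvable: the Volterra operator is
a contraction for an exponentially weighted norm. -/
theorem exists_isPrufer {a b : ℝ} (hab : a ≤ b) {q : ℝ → ℝ} (hq : Measurable q) {K : ℝ}
    (hK : ∀ x, |q x| ≤ K) : ∃ θ : ℝ → ℝ, IsPrufer a b q θ := by
  have hK0 : 0 ≤ K := (abs_nonneg _).trans (hK 0)
  -- The rate is `(1 + K)`-Lipschitz in the angle, so the weight `e^{-l(x-a)}` gives the Volterra
  -- operator the constant `(1 + K) / l = 1/2`.
  set l : ℝ := 2 * (1 + K) with hl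
  have hl0 : 0 < l := by positivity
  -- The unknown `ψ` is the angle times the weight: the sup norm of `ψ` is then the weighted norm of
  -- the angle `G ψ`.
  let G : C(Set.Icc a b, ℝ) → ℝ → ℝ := fun ψ t => Real.exp (l * (t - a)) * Set.IccExtend hab ψ t
  have hG : ∀ ψ, Continuous (G ψ) := fun ψ => by
    have : Continuous (Set.IccExtend hab ψ) := ψ.continuous.Icc_extend'
    fun_prop
  let g : C(Set.Icc a b, ℝ) → ℝ → ℝ := fun ψ t =>
    Real.cos (G ψ t) ^ 2 + q t * Real.sin (G ψ t) ^ 2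
  have hg : ∀ ψ x y, IntervalIntegrable (g ψ) volume x y := fun ψ x y => by
    refine (intervalIntegrable_const (c := 1 + K)).mono_fun ?_ ?_
    · have := (hG ψ).measurable
      exact Measurable.aestronglyMeasurable (by fun_prop)
    · refine ae_of_all _ fun t => ?_
      beta_reduce
      rw [Real.norm_eq_abs, Real.norm_eq_abs, abs_of_nonneg (by positivity : 0 ≤ 1 + K)]
      exact abs_pruferRate_le (hK t) _
  let S : C(Set.Icc a b, ℝ) → C(Set.Icc a b, ℝ) := fun ψ =>
    ⟨fun x => Real.exp (-(l * (x - a))) * ∫ t in a..x, g ψ t, by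
      have := intervalIntegral.continuous_primitive (hg ψ) a
      fun_prop⟩
  have hS : ContractingWith (1 / 2 : NNReal) S := by
    refine ⟨by rw [← NNReal.coe_lt_coe]; norm_num, LipschitzWith.of_dist_le_mul fun ψ φ => ?_⟩
    rw [ContinuousMap.dist_le (by positivity)]
    intro x
    have hx := x.2
    change |Real.exp (-(l * (x - a))) * (∫ t in a..x, g ψ t) -
      Real.exp (-(l * (x - a))) * ∫ t in a..x, g φ t| ≤ _
    rw [← mul_sub, ← intervalIntegral.integral_sub (hg _ _ _) (hg _ _ _), abs_mul,
      abs_of_pos (Real.exp_pos _)]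
    have h1 : |∫ t in a..x, (g ψ t - g φ t)| ≤
        ∫ t in a..x, (1 + K) * dist ψ φ * Real.exp (l * (t - a)) := by
      have hi : Continuous fun t => (1 + K) * dist ψ φ * Real.exp (l * (t - a)) := by fun_prop
      refine intervalIntegral.norm_integral_le_of_norm_le (μ := volume)
        (f := fun t => g ψ t - g φ t) hx.1 (ae_of_all _ fun t ht => ?_)
        (hi.intervalIntegrable (μ := volume) _ _)
      refine (abs_pruferRate_sub_le (hK t) _ _).trans ?_
      rw [mul_assoc]
      gcongr
      simp only [G]
      rw [← mul_sub, abs_mul, abs_of_pos (Real.exp_pos _), mul_comm]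
      gcongr
      exact ContinuousMap.dist_apply_le_dist (f := ψ) (g := φ) (Set.projIcc a b hab t)
    have h2 : ∫ t in a..x, (1 + K) * dist ψ φ * Real.exp (l * (t - a)) =
        1 / 2 * dist ψ φ * (Real.exp (l * (x - a)) - 1) := by
      rw [intervalIntegral.integral_eq_sub_of_hasDerivAt
        (f := fun t => 1 / 2 * dist ψ φ * Real.exp (l * (t - a)))]
      · simp; ring
      · intro t _
        have h := ((((hasDerivAt_id t).sub_const a).const_mul l).exp).const_mul (1 / 2 * dist ψ φ)
        refine h.congr_deriv ?_
        simp only [id, hl]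
        ring
      · exact Continuous.intervalIntegrable (by fun_prop) _ _
    rw [h2] at h1
    have h3 : Real.exp (-(l * (x - a))) * Real.exp (l * (x - a)) = 1 := by
      rw [← Real.exp_add]; simp
    have h4 := mul_le_mul_of_nonneg_left h1 (Real.exp_pos (-(l * (x - a)))).le
    have h5 : 0 ≤ Real.exp (-(l * (x - a))) * dist ψ φ := by positivity
    have h6 : ((1 / 2 : NNReal) : ℝ) = 1 / 2 := by norm_num
    rw [h6]
    linear_combination h4 + 1 / 2 * dist ψ φ * h3 + 1 / 2 * h5
  have hne : Nonempty C(Set.Icc a b, ℝ) := ⟨0⟩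
  obtain ⟨ψ, hψ⟩ : ∃ ψ, S ψ = ψ := ⟨_, hS.fixedPoint_isFixedPt⟩
  have key : ∀ x ∈ Set.Icc a b, G ψ x = ∫ t in a..x, g ψ t := fun x hx => by
    have h1 : ψ ⟨x, hx⟩ = Real.exp (-(l * (x - a))) * ∫ t in a..x, g ψ t :=
      (DFunLike.congr_fun hψ ⟨x, hx⟩).symm
    simp only [G]
    rw [Set.IccExtend_of_mem _ _ hx, h1, ← mul_assoc, ← Real.exp_add]
    simp
  have h0 : G ψ a = 0 := by rw [key a (Set.left_mem_Icc.2 hab)]; simp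
  exact ⟨G ψ, h0, .of_integral hab (hg ψ a b) fun x hx => by rw [h0, zero_add]; exact key x hx⟩

/-- With `sinc` bounded and continuous, this factorization turns nonlinear differences of angles
into linear terms with bounded coefficients, without dividing by zero. -/
theorem sin_eq_mul_sinc (x : ℝ) : Real.sin x = x * Real.sinc x := by
  rcases eq_or_ne x 0 with rfl | hx
  · simp
  · rw [Real.sinc_of_ne_zero hx]; field_simp

namespace IsPrufer

variable {a b : ℝ} {q p θ η : ℝ → ℝ}

/-- The difference of two Prüfer angles solves a linear equation. -/
theorem sub_isPrim (hp : IsPrufer a b p η) (hq : IsPrufer a b q θ) :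
    IsPrim a b (fun x => θ x - η x) fun x =>
      ((q x - 1) * (Real.sinc (θ x - η x) * Real.sin (θ x + η x))) * (θ x - η x) +
        (q x - p x) * Real.sin (η x) ^ 2 :=
  (hq.prim.sub hp.prim).congr_deriv' fun x _ => by
    have h1 := sin_sq_sub_sin_sq (θ x) (η x)
    rw [sin_eq_mul_sinc (θ x - η x)] at h1
    rw [pruferRate_eq, pruferRate_eq]
    linear_combination (q x - 1) * h1

/-- `C` is a primitive of the bounded coefficient in `sub_isPrim`. After multiplication by `e^{-C}`
the derivative of the difference has the sign of `q - p`. Monotonicity, strict monotonicity and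
Lipschitz dependence all follow from this. -/
theorem exists_factor (hab : a ≤ b) (hp : IsPrufer a b p η) (hq : IsPrufer a b q θ)
    (hqm : Measurable q) {K : ℝ} (hK : ∀ x, |q x| ≤ K) :
    ∃ C : ℝ → ℝ, (∀ x ∈ Set.Icc a b, |C x| ≤ (1 + K) * (b - a)) ∧
      IsPrim a b (fun x => (θ x - η x) * Real.exp (-C x))
        fun x => (q x - p x) * Real.sin (η x) ^ 2 * Real.exp (-C x) := by
  have hK0 : 0 ≤ K := (abs_nonneg _).trans (hK 0)
  have hB : ∀ x, |(q x - 1) * (Real.sinc (θ x - η x) * Real.sin (θ x + η x))| ≤ 1 + K := fun x => by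
    rw [abs_mul, abs_mul]
    have h1 : |q x - 1| ≤ 1 + K := (abs_sub (q x) 1).trans (by rw [abs_one]; linarith [hK x])
    have h2 := Real.abs_sinc_le_one (θ x - η x)
    have h3 := Real.abs_sin_le_one (θ x + η x)
    calc _ ≤ (1 + K) * (1 * 1) := by gcongr
      _ = 1 + K := by ring
  have h1 := hp.prim.continuousOn hab
  have h2 := hq.prim.continuousOn hab
  have hm : AEStronglyMeasurable
      (fun x => (q x - 1) * (Real.sinc (θ x - η x) * Real.sin (θ x + η x)))
      (volume.restrict (Set.Icc a b)) := by
    refine AEStronglyMeasurable.mul (by fun_prop) (ContinuousOn.aestronglyMeasurable ?_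
      measurableSet_Icc)
    exact (Real.continuous_sinc.comp_continuousOn (h2.sub h1)).mul
      (Real.continuous_sin.comp_continuousOn (h2.add h1))
  obtain ⟨C, hC0, hC⟩ := exists_isPrim hab (intervalIntegrable_of_bounded hab hm fun x _ => hB x)
  refine ⟨C, fun x hx => ?_, (hp.sub_isPrim hq).integratingFactor hab hC⟩
  have := hC.abs_sub_le hab (fun x _ => hB x) hx
  rw [hC0, sub_zero] at this
  refine this.trans ?_
  gcongr
  exact hx.2

/-- Sturm comparison: the Prüfer angle is monotone in the coefficient. -/
theorem le_of_le (hab : a ≤ b) (hp : IsPrufer a b p η) (hq : IsPrufer a b q θ)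
    (hqm : Measurable q) {K : ℝ} (hK : ∀ x, |q x| ≤ K) (hpq : ∀ x, p x ≤ q x) {x : ℝ}
    (hx : x ∈ Set.Icc a b) : η x ≤ θ x := by
  obtain ⟨C, -, hC⟩ := exists_factor hab hp hq hqm hK
  have h := hC.le_of_nonneg hab (ae_of_all _ fun t _ => mul_nonneg (mul_nonneg
    (sub_nonneg.2 (hpq t)) (sq_nonneg _)) (Real.exp_pos _).le) le_rfl hx.1 hx.2
  rw [hp.zero, hq.zero, sub_zero, zero_mul] at h
  exact sub_nonneg.1 (nonneg_of_mul_nonneg_left h (Real.exp_pos _))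

/-- Equality at `b` would make the monotone function `(θ - η) e^{-C}` vanish identically, hence `sin
η = 0` almost everywhere. Then `η' = 1` and `η x = x - a`, whose sine does not vanish almost
everywhere. -/
theorem lt_of_lt (hab : a < b) (hp : IsPrufer a b p η) (hq : IsPrufer a b q θ)
    (hqm : Measurable q) {K : ℝ} (hK : ∀ x, |q x| ≤ K) (hpq : ∀ x, p x < q x) : η b < θ b := by
  obtain ⟨C, -, hC⟩ := exists_factor hab.le hp hq hqm hK
  refine lt_of_le_of_ne (hp.le_of_le hab.le hq hqm hK (fun x => (hpq x).le)
    (Set.right_mem_Icc.2 hab.le)) fun hb => ?_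
  have hmono := fun {x y : ℝ} => hC.le_of_nonneg (x := x) (y := y) hab.le
    (ae_of_all _ fun t _ => mul_nonneg (mul_nonneg
    (sub_nonneg.2 (hpq t).le) (sq_nonneg _)) (Real.exp_pos _).le)
  have hz : ∀ x ∈ Set.Icc a b, (θ x - η x) * Real.exp (-C x) = 0 := fun x hx => by
    have h1 := hmono le_rfl hx.1 hx.2
    have h2 := hmono hx.1 hx.2 le_rfl
    rw [hp.zero, hq.zero, sub_zero, zero_mul] at h1
    rw [hb, sub_self, zero_mul] at h2
    exact le_antisymm h2 h1
  have hs : ∀ᵐ x, x ∈ Set.Ioo a b → Real.sin (η x) = 0 := by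
    filter_upwards [hC.deriv] with x h hx
    have h1 : HasDerivAt (fun x => (θ x - η x) * Real.exp (-C x)) 0 x :=
      (hasDerivAt_const x (0 : ℝ)).congr_of_eventuallyEq (by
        filter_upwards [Icc_mem_nhds hx.1 hx.2] with y hy using hz y hy)
    have h2 := (h hx).unique h1
    rcases mul_eq_zero.1 h2 with h3 | h3
    · rcases mul_eq_zero.1 h3 with h4 | h4
      · exact absurd h4 (sub_pos.2 (hpq x)).ne'
      · exact pow_eq_zero_iff two_ne_zero |>.1 h4
    · exact absurd h3 (Real.exp_pos _).ne'
  have hlin : ∀ x ∈ Set.Icc a b, η x = x - a := fun x hx => by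
    have h := (hp.prim.sub (IsPrim.of_hasDerivAt (F := fun x => x) (by fun_prop)
      fun x => hasDerivAt_id x)).eq_of_deriv_zero hab.le (by
        filter_upwards [hs] with t h ht
        rw [pruferRate_eq, h ht]; ring) hx
    rw [hp.zero] at h
    linarith
  have h1 : ∀ᵐ x, x ∈ Set.Ioo a b → Real.sin (x - a) = 0 := by
    filter_upwards [hs] with x h hx
    rw [← hlin x (Set.Ioo_subset_Ioo_right le_rfl |>.trans Set.Ioo_subset_Icc_self <| hx)]
    exact h hx
  have h2 : Set.EqOn (fun x => Real.sin (x - a)) 0 (Set.Icc a b) := by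
    refine Measure.eqOn_Icc_of_ae_eq (volume : Measure ℝ) hab.ne ?_ (by fun_prop) (by fun_prop)
    refine (ae_restrict_iff' measurableSet_Icc).2 ?_
    filter_upwards [h1, ae_mem_Icc_imp_mem_Ioo a b] with x h3 h4 h5 using h3 (h4 h5)
  -- A length that stays within the interval and inside `(0, π)`.
  have hm : 0 < min (b - a) 1 := lt_min (sub_pos.2 hab) one_pos
  have h3 := h2 (x := a + min (b - a) 1)
    ⟨by linarith, by linarith [min_le_left (b - a) (1 : ℝ)]⟩
  simp only [add_sub_cancel_left, Pi.zero_apply] at h3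
  exact (Real.sin_pos_of_pos_of_lt_pi hm
    ((min_le_right _ _).trans_lt (by linarith [Real.pi_gt_three]))).ne' h3

/-- The Prüfer angle depends Lipschitz continuously on the coefficient. -/
theorem abs_sub_le (hab : a ≤ b) (hp : IsPrufer a b p η) (hq : IsPrufer a b q θ)
    (hqm : Measurable q) {K δ : ℝ} (hK : ∀ x, |q x| ≤ K) (hpq : ∀ x, |q x - p x| ≤ δ) :
    |θ b - η b| ≤ δ * Real.exp ((1 + K) * (b - a)) * (b - a) * Real.exp ((1 + K) * (b - a)) := by
  obtain ⟨C, hCb, hC⟩ := exists_factor hab hp hq hqm hK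
  have hδ : 0 ≤ δ := (abs_nonneg _).trans (hpq 0)
  have h := hC.abs_sub_le hab (B := δ * Real.exp ((1 + K) * (b - a))) (fun x hx => by
    rw [abs_mul, abs_mul, abs_of_pos (Real.exp_pos _), abs_of_nonneg (sq_nonneg (Real.sin _))]
    have h1 := (abs_le.1 (hCb x (Set.Ioo_subset_Icc_self hx))).1
    have h2 := Real.sin_sq_le_one (η x)
    calc _ ≤ δ * 1 * Real.exp ((1 + K) * (b - a)) := by
          gcongr
          · exact hpq x
          · linarith
      _ = _ := by ring) (Set.right_mem_Icc.2 hab)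
  rw [hp.zero, hq.zero, sub_zero, zero_mul, sub_zero, abs_mul, abs_of_pos (Real.exp_pos _)] at h
  have h1 := (abs_le.1 (hCb b (Set.right_mem_Icc.2 hab))).2
  calc |θ b - η b| = |θ b - η b| * Real.exp (-C b) * Real.exp (C b) := by
        rw [mul_assoc, ← Real.exp_add]; simp
    _ ≤ _ := by gcongr

end IsPrufer

/-! ### Explicit Prüfer angles for constant coefficients. -/

/-- The Prüfer angle for `q = 0`. -/
theorem isPrufer_zero (a b : ℝ) : IsPrufer a b (fun _ => 0) fun x => Real.arctan (x - a) := by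
  refine ⟨by simp, .of_hasDerivAt (Real.contDiff_arctan.comp (by fun_prop)) fun x => ?_⟩
  refine (((hasDerivAt_id x).sub_const a).arctan).congr_deriv ?_
  rw [Real.cos_sq_arctan]
  simp

/-- The Prüfer angle for a positive constant `q = k ^ 2`. -/
theorem isPrufer_sq (a b : ℝ) {k : ℝ} (hk : 0 < k) :
    IsPrufer a b (fun _ => k ^ 2) fun x => k * (x - a) + Real.arctan
      ((1 - k) * Real.sin (k * (x - a)) * Real.cos (k * (x - a)) /
        (k * Real.cos (k * (x - a)) ^ 2 + Real.sin (k * (x - a)) ^ 2)) := by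
  -- With `y = k (x - a)` the solution `sin y / k` has `tan θ = tan y / k`. The addition formula for
  -- `tan (θ - y)` gives the arctangent term; its denominator never vanishes, so the formula is
  -- smooth across the poles of `tan`.
  have hpos : ∀ y, 0 < k * Real.cos y ^ 2 + Real.sin y ^ 2 := fun y => by
    rcases eq_or_ne (Real.sin y) 0 with h | h
    · have h2 := Real.sin_sq_add_cos_sq y
      rw [h] at h2 ⊢
      have : Real.cos y ^ 2 = 1 := by linarith
      rw [this]; simpa
    · positivity
  refine ⟨by simp, .of_hasDerivAt ?_ fun x => ?_⟩
  · refine ContDiff.add (by fun_prop) (Real.contDiff_arctan.comp (ContDiff.div ?_ ?_ ?_))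
    · fun_prop
    · fun_prop
    · exact fun x => (hpos _).ne'
  · have hx : HasDerivAt (fun x => k * (x - a)) k x :=
      (((hasDerivAt_id x).sub_const a).const_mul k).congr_deriv (by simp)
    have hs := hx.sin
    have hc := hx.cos
    have hnum := (hs.const_mul (1 - k)).mul hc
    have hden := ((hc.pow 2).const_mul k).add (hs.pow 2)
    have h := hx.add (hnum.div hden (hpos _).ne').arctan
    refine h.congr_deriv ?_
    have hp := hpos (k * (x - a))
    have hsc := Real.sin_sq_add_cos_sq (k * (x - a))
    simp only [Pi.add_apply, Pi.mul_apply, Pi.pow_apply, Pi.div_apply]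
    rw [Real.cos_add, Real.sin_add, Real.cos_arctan, Real.sin_arctan]
    set s := Real.sin (k * (x - a))
    set c := Real.cos (k * (x - a))
    obtain ⟨h, hh⟩ : ∃ h, h = k * c ^ 2 + s ^ 2 := ⟨_, rfl⟩
    obtain ⟨g, hg⟩ : ∃ g, g = (1 - k) * s * c := ⟨_, rfl⟩
    -- In complex form, `(h + i g) e^{iy} = k c + i s`: the rotation by `y` takes the vector `(h,
    -- g)` to one in the direction of `θ`.
    have e1 : c * h - s * g = k * c := by rw [hh, hg]; linear_combination k * c * hsc
    have e2 : s * h + c * g = s := by rw [hh, hg]; linear_combination s * hsc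
    have e3 : h ^ 2 + g ^ 2 = s ^ 2 + k ^ 2 * c ^ 2 := by
      have : (c * h - s * g) ^ 2 + (s * h + c * g) ^ 2 = h ^ 2 + g ^ 2 := by
        linear_combination (h ^ 2 + g ^ 2) * hsc
      rw [e1, e2] at this
      linear_combination -this
    obtain ⟨N, hN⟩ : ∃ N, N = ((1 - k) * (c * k) * c + (1 - k) * s * (-s * k)) * h -
      g * (k * (↑2 * c ^ (2 - 1) * (-s * k)) + ↑2 * s ^ (2 - 1) * (c * k)) := ⟨_, rfl⟩
    have e4 : N = k * (1 - k) * (k * c ^ 2 - s ^ 2) := by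
      rw [hN, hh, hg]
      simp only [Nat.add_one_sub_one, pow_one]
      linear_combination (1 - k) * k * (k * c ^ 2 - s ^ 2) * hsc
    rw [← hh] at hp ⊢
    rw [← hg]
    have hD : 0 < h ^ 2 + g ^ 2 := by positivity
    obtain ⟨w, hw⟩ : ∃ w, w = Real.sqrt (1 + (g / h) ^ 2) := ⟨_, rfl⟩
    have hw2 : w ^ 2 = 1 + (g / h) ^ 2 := by rw [hw, Real.sq_sqrt (by positivity)]
    have hw0 : 0 < w := by rw [hw]; positivity
    have e5 : h ^ 2 * w ^ 2 = h ^ 2 + g ^ 2 := by rw [hw2]; field_simp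
    rw [← hw]
    have e6 : (c * (1 / w) - s * (g / h / w)) ^ 2 + k ^ 2 * (s * (1 / w) + c * (g / h / w)) ^ 2 =
        ((c * h - s * g) ^ 2 + k ^ 2 * (s * h + c * g) ^ 2) / (h ^ 2 * w ^ 2) := by
      field_simp
    have e7 : k + 1 / (1 + (g / h) ^ 2) * (N / h ^ 2) = k + N / (h ^ 2 + g ^ 2) := by
      rw [← e5, ← hw2]; field_simp
    rw [e6, e1, e2, e5]
    trans k + 1 / (1 + (g / h) ^ 2) * (N / h ^ 2)
    · rw [hN]; simp
    · rw [e7, e4]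
      field_simp
      rw [e3]
      ring

/-! ### The Prüfer radius and the solutions of the linear equation. -/

namespace IsPrufer

variable {a b : ℝ} {q θ : ℝ → ℝ}

/-- The logarithm of the Prüfer radius. -/
theorem exists_logRadius (hab : a ≤ b) (h : IsPrufer a b q θ) (hq : Measurable q) {K : ℝ}
    (hK : ∀ x, |q x| ≤ K) : ∃ R : ℝ → ℝ, R a = 0 ∧
      IsPrim a b R fun x => (1 - q x) * (Real.sin (θ x) * Real.cos (θ x)) := by
  have hK0 : 0 ≤ K := (abs_nonneg _).trans (hK 0)
  have hθ := h.prim.continuousOn hab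
  refine exists_isPrim hab (intervalIntegrable_of_bounded (B := 1 + K) hab ?_ fun x _ => ?_)
  · exact AEStronglyMeasurable.mul (by fun_prop)
      (ContinuousOn.aestronglyMeasurable (by fun_prop) measurableSet_Icc)
  · rw [abs_mul, abs_mul]
    have h1 : |1 - q x| ≤ 1 + K := (abs_sub 1 (q x)).trans (by rw [abs_one]; linarith [hK x])
    have h2 := Real.abs_sin_le_one (θ x)
    have h3 := Real.abs_cos_le_one (θ x)
    calc _ ≤ (1 + K) * (1 * 1) := by gcongr
      _ = 1 + K := by ring

/-- The solution of the linear equation built from the Prüfer variables. -/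
theorem isPrim_sin (hab : a ≤ b) (h : IsPrufer a b q θ) {R : ℝ → ℝ}
    (hR : IsPrim a b R fun x => (1 - q x) * (Real.sin (θ x) * Real.cos (θ x))) :
    IsPrim a b (fun x => Real.exp (R x) * Real.sin (θ x))
      fun x => Real.exp (R x) * Real.cos (θ x) :=
  ((hR.exp hab).mul (h.prim.sin hab)).congr_deriv' fun x _ => by
    linear_combination (Real.exp (R x) * Real.cos (θ x)) * Real.sin_sq_add_cos_sq (θ x)

theorem isPrim_cos (hab : a ≤ b) (h : IsPrufer a b q θ) {R : ℝ → ℝ}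
    (hR : IsPrim a b R fun x => (1 - q x) * (Real.sin (θ x) * Real.cos (θ x))) :
    IsPrim a b (fun x => Real.exp (R x) * Real.cos (θ x))
      fun x => -q x * (Real.exp (R x) * Real.sin (θ x)) :=
  ((hR.exp hab).mul (h.prim.cos hab)).congr_deriv' fun x _ => by
    linear_combination (-q x * Real.exp (R x) * Real.sin (θ x)) * Real.sin_sq_add_cos_sq (θ x)

/-- Every solution of `u' = v`, `v' = -q u`, `u a = 0` is a multiple of the one built from the
Prüfer variables. -/
theorem eq_mul_sin (hab : a ≤ b) (h : IsPrufer a b q θ) {R u v : ℝ → ℝ} (hR0 : R a = 0)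
    (hR : IsPrim a b R fun x => (1 - q x) * (Real.sin (θ x) * Real.cos (θ x)))
    (hu : IsPrim a b u v) (hv : IsPrim a b v fun x => -q x * u x) (hu0 : u a = 0)
    {x : ℝ} (hx : x ∈ Set.Icc a b) : u x = v a * (Real.exp (R x) * Real.sin (θ x)) := by
  have hs := h.prim.sin hab
  have hc := h.prim.cos hab
  have hsc := fun x => Real.sin_sq_add_cos_sq (θ x)
  -- In the frame rotating with `θ`, this component of `(v, u)` orthogonal to `(cos θ, sin θ)`
  -- solves a homogeneous linear equation with initial value zero, so it vanishes. The parallel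
  -- component `hA` then grows exactly like `e^R`.
  have hB : IsPrim a b (fun x => u x * Real.cos (θ x) - v x * Real.sin (θ x)) fun x =>
      (-((1 - q x) * (Real.sin (θ x) * Real.cos (θ x)))) *
        (u x * Real.cos (θ x) - v x * Real.sin (θ x)) + 0 :=
    ((hu.mul hc).sub (hv.mul hs)).congr_deriv' fun x _ => by
      linear_combination (-v x * Real.cos (θ x) - q x * u x * Real.sin (θ x)) * hsc x
  have hB0 : ∀ x ∈ Set.Icc a b, u x * Real.cos (θ x) - v x * Real.sin (θ x) = 0 := fun x hx => by
    have := (hB.integratingFactor hab hR.neg).eq_of_deriv_zero hab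
      (ae_of_all _ fun x _ => by simp) hx
    simp only [hu0, h.zero, Real.sin_zero, zero_mul, mul_zero, sub_zero] at this
    exact (mul_eq_zero.1 this).resolve_right (Real.exp_pos _).ne'
  have hA : IsPrim a b (fun x => u x * Real.sin (θ x) + v x * Real.cos (θ x)) fun x =>
      ((1 - q x) * (Real.sin (θ x) * Real.cos (θ x))) *
        (u x * Real.sin (θ x) + v x * Real.cos (θ x)) + 0 :=
    ((hu.mul hs).add (hv.mul hc)).congr_deriv' fun x hx => by
      have := hB0 x (Set.Ioo_subset_Icc_self hx)
      linear_combination (Real.cos (θ x) ^ 2 + q x * Real.sin (θ x) ^ 2 - Real.sin (θ x) ^ 2 -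
        q x * Real.cos (θ x) ^ 2) * this - (v x * Real.sin (θ x) - q x * u x * Real.cos (θ x)) * hsc x
  have hA0 := (hA.integratingFactor hab hR).eq_of_deriv_zero hab
      (ae_of_all _ fun x _ => by simp) hx
  simp only [hu0, h.zero, hR0, Real.cos_zero, zero_mul, mul_one, neg_zero, Real.exp_zero,
    zero_add] at hA0
  have e1 : Real.exp (-R x) * Real.exp (R x) = 1 := by rw [← Real.exp_add]; simp
  have hb := hB0 x hx
  rw [← hA0]
  linear_combination Real.cos (θ x) * hb - u x * hsc x -
    (u x * Real.sin (θ x) + v x * Real.cos (θ x)) * Real.sin (θ x) * e1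

end IsPrufer

/-! ### Eigenfunctions in `L²` and the Prüfer angle. -/

theorem IsPrim.of_hasDerivWithinAt {a b : ℝ} (hab : a ≤ b) {F f : ℝ → ℝ}
    (h : ∀ x ∈ Set.Icc a b, HasDerivWithinAt F (f x) (Set.Icc a b) x)
    (hf : ContinuousOn f (Set.Icc a b)) : IsPrim a b F f := by
  obtain ⟨C, hC⟩ := isCompact_Icc.exists_bound_of_continuousOn hf
  refine ⟨LipschitzOnWith.absolutelyContinuousOnInterval (K := C.toNNReal) ?_,
    ae_of_all _ fun x hx => (h x (Set.Ioo_subset_Icc_self hx)).hasDerivAt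
      (Icc_mem_nhds hx.1 hx.2)⟩
  rw [Set.uIcc_of_le hab]
  refine (convex_Icc a b).lipschitzOnWith_of_nnnorm_hasDerivWithin_le h fun x hx => ?_
  rw [← NNReal.coe_le_coe, coe_nnnorm]
  exact (hC x hx).trans (Real.le_coe_toNNReal C)

/-- Continuity of `f` upgrades the almost everywhere derivative to one at every point, endpoints
included, as the operator domain demands. `IccExtend` makes the integrand continuous across the
endpoints. -/
theorem IsPrim.hasDerivWithinAt {a b : ℝ} (hab : a ≤ b) {F f : ℝ → ℝ} (h : IsPrim a b F f)
    (hf : ContinuousOn f (Set.Icc a b)) {x : ℝ} (hx : x ∈ Set.Icc a b) :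
    HasDerivWithinAt F (f x) (Set.Icc a b) x := by
  have hF : ∀ y ∈ Set.Icc a b, F y = F a + ∫ t in a..y, Set.IccExtend hab
      (Set.domRestrict (Set.Icc a b) f) t := fun y hy => by
    have h1 := h.integral_eq hab hy
    rw [eq_add_of_sub_eq' h1]
    congr 1
    refine intervalIntegral.integral_congr fun t ht => ?_
    rw [Set.uIcc_of_le hy.1] at ht
    exact (Set.IccExtend_of_mem hab (Set.domRestrict (Set.Icc a b) f) ⟨ht.1, ht.2.trans hy.2⟩).symm
  have hc : Continuous (Set.IccExtend hab (Set.domRestrict (Set.Icc a b) f)) :=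
    (continuousOn_iff_continuous_domRestrict.1 hf).Icc_extend'
  have h2 := (intervalIntegral.integral_hasDerivAt_right (hc.intervalIntegrable a x)
    (hc.stronglyMeasurableAtFilter _ _) hc.continuousAt).const_add (F a)
  rw [Set.IccExtend_of_mem hab _ hx] at h2
  exact h2.hasDerivWithinAt.congr hF (hF x hx)

theorem mem_eigenspace_iff {a b : ℝ} {W : ℝ → ℝ} {E : ℝ} {f : L2 a b} :
    f ∈ eigenspace a b W E ↔ ∃ w : L2 a b, HasDirichletSecondDeriv f w ∧
      ∀ᵐ x ∂((volume : Measure ℝ).restrict (Set.Icc a b)), w x = -((E - W x : ℝ) : ℂ) * f x := by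
  change (f, (E : ℂ) • f) ∈ (hamiltonian a b W).graph ↔ _
  rw [hamiltonian_graph]
  refine exists_congr fun w => and_congr_right fun _ => eventually_congr ?_
  filter_upwards [Lp.coeFn_smul (E : ℂ) f] with x hx
  simp only [hx, Pi.smul_apply, smul_eq_mul]
  push_cast
  constructor <;> intro h <;> linear_combination h

section

variable {a b E : ℝ} {W θ R : ℝ → ℝ}

/-- Eigenfunctions are multiples of the solution built from the Prüfer variables. -/
theorem eigenfunction_ae_eq (hab : a < b) (h : IsPrufer a b (fun x => E - W x) θ) (hR0 : R a = 0)
    (hR : IsPrim a b R fun x => (1 - (E - W x)) * (Real.sin (θ x) * Real.cos (θ x)))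
    {f : L2 a b} (hf : f ∈ eigenspace a b W E) :
    ∃ c : ℂ, c * Real.sin (θ b) = 0 ∧ ∀ᵐ x ∂((volume : Measure ℝ).restrict (Set.Icc a b)),
      f x = c * (Real.exp (R x) * Real.sin (θ x) : ℝ) := by
  obtain ⟨w, ⟨u, v, h1, h2, h3, h4, h5⟩, h6⟩ := mem_eigenspace_iff.1 hf
  have hw := intervalIntegrable_L2 w (Set.right_mem_Icc.2 hab.le)
  -- The potential and `E` are real, so real and imaginary parts separately solve the real equation.
  have key : ∀ L : ℂ →L[ℝ] ℝ, ∀ x ∈ Set.Icc a b,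
      L (u x) = L (v a) * (Real.exp (R x) * Real.sin (θ x)) := by
    intro L x hx
    have hv : IsPrim a b (fun x => L (v x)) fun x => L (w x) :=
      IsPrim.of_integral hab.le
        (intervalIntegrable_iff.2 (L.integrable_comp (intervalIntegrable_iff.1 hw))) fun x hx => by
        rw [h2 x hx, map_add, h2 a (Set.left_mem_Icc.2 hab.le),
          L.intervalIntegral_comp_comm (intervalIntegrable_L2 w hx)]
    have hu : IsPrim a b (fun x => L (u x)) fun x => L (v x) :=
      IsPrim.of_hasDerivWithinAt hab.le
        (fun x hx => L.hasFDerivAt.comp_hasDerivWithinAt x (h1 x hx)) (hv.continuousOn hab.le)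
    refine h.eq_mul_sin hab.le hR0 hR hu (hv.congr_deriv ?_) (by simp [h3]) hx
    rw [ae_restrict_iff' measurableSet_Icc] at h5 h6
    filter_upwards [h5, h6] with t h7 h8 ht
    rw [h8 (Set.Ioo_subset_Icc_self ht), h7 (Set.Ioo_subset_Icc_self ht), ← Complex.ofReal_neg,
      ← Complex.real_smul, map_smul, smul_eq_mul]
  have hu : ∀ x ∈ Set.Icc a b, u x = v a * (Real.exp (R x) * Real.sin (θ x) : ℝ) := fun x hx => by
    apply Complex.ext
    · rw [Complex.re_mul_ofReal]; exact key Complex.reCLM x hx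
    · rw [Complex.im_mul_ofReal]; exact key Complex.imCLM x hx
  refine ⟨v a, ?_, ?_⟩
  · have := hu b (Set.right_mem_Icc.2 hab.le)
    rw [h4, Complex.ofReal_mul, eq_comm, mul_left_comm] at this
    exact (mul_eq_zero.1 this).resolve_left (Complex.ofReal_ne_zero.2 (Real.exp_pos _).ne')
  · filter_upwards [h5, ae_restrict_mem measurableSet_Icc] with x h7 hx
    rw [h7, hu x hx]

theorem memLp_ofReal_of_bounded {g : ℝ → ℝ} {B : ℝ}
    (hm : AEStronglyMeasurable g (volume.restrict (Set.Icc a b)))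
    (hB : ∀ x ∈ Set.Icc a b, |g x| ≤ B) :
    MemLp (fun x => (g x : ℂ)) 2 (volume.restrict (Set.Icc a b)) :=
  MemLp.of_bound (Complex.continuous_ofReal.comp_aestronglyMeasurable hm) B
    ((ae_restrict_iff' measurableSet_Icc).2 (ae_of_all _ fun x hx => by
      rw [Complex.norm_real]; exact hB x hx))

theorem eigenspace_ne_bot (hab : a < b) (hW : Measurable W) {M : ℝ} (hM : ∀ x, |W x| ≤ M)
    (h : IsPrufer a b (fun x => E - W x) θ)
    (hR : IsPrim a b R fun x => (1 - (E - W x)) * (Real.sin (θ x) * Real.cos (θ x)))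
    (hb : Real.sin (θ b) = 0) : eigenspace a b W E ≠ ⊥ := by
  set φ := fun x => Real.exp (R x) * Real.sin (θ x) with hφ
  set ψ := fun x => Real.exp (R x) * Real.cos (θ x) with hψ
  have h1 : IsPrim a b φ ψ := h.isPrim_sin hab.le hR
  have h2 : IsPrim a b ψ fun x => -(E - W x) * φ x := h.isPrim_cos hab.le hR
  have hφc := h1.continuousOn hab.le
  have hψc := h2.continuousOn hab.le
  obtain ⟨B, hB⟩ := isCompact_Icc.exists_bound_of_continuousOn hφc
  have hmφ := hφc.aestronglyMeasurable (μ := volume) measurableSet_Icc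
  have hLφ := memLp_ofReal_of_bounded hmφ hB
  have hLw := memLp_ofReal_of_bounded (a := a) (b := b) (g := fun x => -(E - W x) * φ x)
    (B := (|E| + M) * B) (AEStronglyMeasurable.mul (by fun_prop) hmφ) fun x hx => by
      rw [abs_mul, abs_neg]
      have e1 : |E - W x| ≤ |E| + M := (abs_sub _ _).trans (by linarith [hM x])
      have e2 : 0 ≤ |E| + M := (abs_nonneg _).trans e1
      exact mul_le_mul e1 (hB x hx) (abs_nonneg _) e2
  rw [Submodule.ne_bot_iff]
  refine ⟨hLφ.toLp, mem_eigenspace_iff.2 ⟨hLw.toLp, ⟨fun x => φ x, fun x => ψ x, fun x hx =>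
    (h1.hasDerivWithinAt hab.le hψc hx).ofReal_comp, fun x hx => ?_, ?_, ?_, hLφ.coeFn_toLp⟩, ?_⟩, ?_⟩
  · rw [intervalIntegral_congr_L2 hx hLw.coeFn_toLp, intervalIntegral.integral_ofReal,
      ← h2.integral_eq hab.le hx]
    push_cast; ring
  · simp [hφ, h.zero]
  · simp [hφ, hb]
  · filter_upwards [hLφ.coeFn_toLp, hLw.coeFn_toLp] with x e1 e2
    rw [e1, e2]
    push_cast; ring
  · intro h0
    have e0 : φ =ᵐ[volume.restrict (Set.Icc a b)] 0 := by
      filter_upwards [hLφ.coeFn_toLp, Lp.coeFn_zero ℂ 2 ((volume : Measure ℝ).restrict (Set.Icc a b))]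
        with x e1 e2
      rw [h0, e2] at e1
      exact Complex.ofReal_eq_zero.1 e1.symm
    -- A zero class would force `φ = 0` on all of `[a, b]`, but its derivative at `a` is `e^{R a} ≠
    -- 0`.
    have e1 := Measure.eqOn_Icc_of_ae_eq (volume : Measure ℝ) hab.ne e0 hφc continuousOn_const
    have ha := Set.left_mem_Icc.2 hab.le
    have e2 := (uniqueDiffOn_Icc hab a ha).eq_deriv _ (h1.hasDerivWithinAt hab.le hψc ha)
      ((hasDerivWithinAt_const a (Set.Icc a b) (0 : ℝ)).congr e1 (e1 ha))
    simp [hψ, h.zero] at e2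

theorem mem_eigenvalueSet_iff (hab : a < b) (hW : Measurable W) {M : ℝ} (hM : ∀ x, |W x| ≤ M)
    (h : IsPrufer a b (fun x => E - W x) θ) :
    E ∈ eigenvalueSet a b W ↔ Real.sin (θ b) = 0 := by
  obtain ⟨R, hR0, hR⟩ := h.exists_logRadius hab.le (by fun_prop) (K := |E| + M)
    fun x => (abs_sub _ _).trans (by linarith [hM x])
  refine ⟨fun hE => ?_, eigenspace_ne_bot hab hW hM h hR⟩
  obtain ⟨f, hf, hf0⟩ := Submodule.exists_mem_ne_zero_of_ne_bot hE
  obtain ⟨c, hc, hfc⟩ := eigenfunction_ae_eq hab h hR0 hR hf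
  rcases mul_eq_zero.1 hc with hc | hc
  · refine absurd ((Lp.eq_zero_iff_ae_eq_zero).2 ?_) hf0
    filter_upwards [hfc] with x hx
    rw [hx, hc, zero_mul, Pi.zero_apply]
  · exact_mod_cast hc

theorem finrank_eigenspace (hab : a < b) (hW : Measurable W) {M : ℝ} (hM : ∀ x, |W x| ≤ M)
    (hE : E ∈ eigenvalueSet a b W) : Module.finrank ℂ (eigenspace a b W E) = 1 := by
  have hK : ∀ x, |E - W x| ≤ |E| + M := fun x => (abs_sub _ _).trans (by linarith [hM x])
  obtain ⟨θ, h⟩ := exists_isPrufer hab.le (q := fun x => E - W x) (by fun_prop) hK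
  obtain ⟨R, hR0, hR⟩ := h.exists_logRadius hab.le (by fun_prop) hK
  obtain ⟨f, hf, hf0⟩ := Submodule.exists_mem_ne_zero_of_ne_bot hE
  obtain ⟨c, -, hfc⟩ := eigenfunction_ae_eq hab h hR0 hR hf
  have hc : c ≠ 0 := by
    rintro rfl
    refine hf0 ((Lp.eq_zero_iff_ae_eq_zero).2 ?_)
    filter_upwards [hfc] with x hx
    rw [hx, zero_mul, Pi.zero_apply]
  refine (finrank_eq_one_iff_of_nonzero' (⟨f, hf⟩ : eigenspace a b W E)
    fun h => hf0 (congrArg Subtype.val h)).2 ?_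
  rintro ⟨g, hg⟩
  obtain ⟨d, -, hgd⟩ := eigenfunction_ae_eq hab h hR0 hR hg
  refine ⟨d / c, Subtype.ext (Lp.ext ?_)⟩
  change ((d / c) • f : L2 a b) =ᵐ[_] g
  filter_upwards [hfc, hgd, Lp.coeFn_smul (d / c) f] with x e1 e2 e3
  rw [e3, Pi.smul_apply, e1, e2, smul_eq_mul]
  field_simp

end

/-! ### Enumeration and bounds of the eigenvalues. -/

/-- The angle solves `θ' = (bounded) θ + 1` with `θ a = 0`, so `θ e^{-C}` has derivative `e^{-C}`,
bounded below by a positive constant. This excludes the multiples `n π` with `n ≤ 0` from the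
spectrum. -/
theorem IsPrufer.pos {a b : ℝ} {q θ : ℝ → ℝ} (hab : a < b) (h : IsPrufer a b q θ)
    (hq : Measurable q) {K : ℝ} (hK : ∀ x, |q x| ≤ K) : 0 < θ b := by
  have hK0 : 0 ≤ K := (abs_nonneg _).trans (hK 0)
  have hθ := h.prim.continuousOn hab.le
  have hB : ∀ x ∈ Set.Icc a b, |(q x - 1) * (Real.sinc (θ x) * Real.sin (θ x))| ≤ 1 + K :=
    fun x _ => by
      rw [abs_mul, abs_mul]
      have h1 : |q x - 1| ≤ 1 + K := (abs_sub (q x) 1).trans (by rw [abs_one]; linarith [hK x])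
      have h2 := Real.abs_sinc_le_one (θ x)
      have h3 := Real.abs_sin_le_one (θ x)
      calc _ ≤ (1 + K) * (1 * 1) := by gcongr
        _ = 1 + K := by ring
  obtain ⟨C, -, hC⟩ := exists_isPrim hab.le (intervalIntegrable_of_bounded hab.le
    (AEStronglyMeasurable.mul (by fun_prop) (ContinuousOn.aestronglyMeasurable
      ((Real.continuous_sinc.comp_continuousOn hθ).mul (Real.continuous_sin.comp_continuousOn hθ))
      measurableSet_Icc)) hB)
  have h1 : IsPrim a b θ fun x =>
      ((q x - 1) * (Real.sinc (θ x) * Real.sin (θ x))) * θ x + 1 :=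
    h.prim.congr_deriv' fun x _ => by
      rw [pruferRate_eq]
      linear_combination (q x - 1) * Real.sin (θ x) * sin_eq_mul_sinc (θ x)
  have h2 := h1.integratingFactor hab.le hC
  obtain ⟨B, hB⟩ := isCompact_Icc.exists_bound_of_continuousOn (hC.continuousOn hab.le)
  have h3 := (h2.sub (IsPrim.of_hasDerivAt (F := fun x => Real.exp (-B) * x) (by fun_prop)
    fun x => ((hasDerivAt_id x).const_mul (Real.exp (-B))))).le_of_nonneg hab.le
    (ae_of_all _ fun x hx => by
      have := (abs_le.1 (hB x (Set.Ioo_subset_Icc_self hx))).2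
      rw [one_mul, mul_one, sub_nonneg]
      exact Real.exp_le_exp.2 (by linarith)) le_rfl hab.le le_rfl
  rw [h.zero] at h3
  have h4 : 0 < Real.exp (-B) * (b - a) := mul_pos (Real.exp_pos _) (sub_pos.2 hab)
  exact pos_of_mul_pos_left (by linarith : 0 < θ b * Real.exp (-C b)) (Real.exp_pos _).le

/-- Identifies `energy` with any strictly increasing enumeration of the eigenvalues: at least `k +
1` of them lie below `t` exactly when `e k ≤ t`. -/
theorem sInf_encard_eq {e : ℕ → ℝ} (he : StrictMono e) (k : ℕ) :
    sInf {t : ℝ | ((k + 1 : ℕ) : ℕ∞) ≤ (Set.range e ∩ Set.Iic t).encard} = e k := by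
  have h : {t : ℝ | ((k + 1 : ℕ) : ℕ∞) ≤ (Set.range e ∩ Set.Iic t).encard} = Set.Ici (e k) := by
    ext t
    simp only [Set.mem_ofPred_eq, Set.mem_Ici]
    constructor
    · intro h
      by_contra! ht
      have h1 : Set.range e ∩ Set.Iic t ⊆ e '' (Finset.range k : Set ℕ) := by
        rintro _ ⟨⟨j, rfl⟩, hj⟩
        exact ⟨j, by simpa using he.lt_iff_lt.1 (lt_of_le_of_lt hj ht), rfl⟩
      have h2 := h.trans ((Set.encard_le_encard h1).trans (Set.encard_image_le _ _))
      rw [Set.encard_coe_eq_coe_finsetCard, Finset.card_range] at h2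
      exact absurd (Nat.cast_le.1 h2) (by omega)
    · intro h
      have h1 : e '' (Finset.range (k + 1) : Set ℕ) ⊆ Set.range e ∩ Set.Iic t := by
        rintro _ ⟨j, hj, rfl⟩
        refine ⟨⟨j, rfl⟩, (he.monotone ?_).trans h⟩
        have : j < k + 1 := by simpa using hj
        omega
      have h2 := Set.encard_le_encard h1
      rwa [he.injective.encard_image, Set.encard_coe_eq_coe_finsetCard, Finset.card_range] at h2
  rw [h, csInf_Ici]

/-- The eigenvalues, enumerated by the Prüfer angle at the right end point, and their bounds by
those of the constant potentials `± M`. -/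
theorem exists_eigenvalue_enumeration {a b M : ℝ} (hab : a < b) {W : ℝ → ℝ} (hW : Measurable W)
    (hM : ∀ x, |W x| ≤ M) : ∃ e : ℕ → ℝ, StrictMono e ∧ Set.range e = eigenvalueSet a b W ∧
      ∀ k : ℕ, (Real.pi / (b - a) * (k + 1 / 2)) ^ 2 - M ≤ e k ∧
        e k ≤ (Real.pi / (b - a) * (k + 3 / 2)) ^ 2 + M := by
  have hL : 0 < b - a := sub_pos.2 hab
  have hpi := Real.pi_pos
  have hm : ∀ E, Measurable fun x => E - W x := fun E => by fun_prop
  have hK : ∀ E x, |E - W x| ≤ |E| + M := fun E x => (abs_sub _ _).trans (by linarith [hM x])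
  choose Θ hΘ using fun E => exists_isPrufer hab.le (hm E) (hK E)
  obtain ⟨N, hN⟩ : ∃ N : ℝ → ℝ, ∀ E, N E = Θ E b := ⟨_, fun _ => rfl⟩
  have hmono : StrictMono N := fun E F hEF => by
    rw [hN, hN]
    exact (hΘ E).lt_of_lt hab (hΘ F) (hm F) (hK F) fun x => by linarith
  have hpos : ∀ E, 0 < N E := fun E => by rw [hN]; exact (hΘ E).pos hab (hm E) (hK E)
  have hcont : Continuous N := continuous_iff_continuousAt.2 fun E => by
    refine continuousAt_of_locally_lipschitz one_pos (Real.exp ((1 + (|E| + M)) * (b - a)) *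
      (b - a) * Real.exp ((1 + (|E| + M)) * (b - a))) fun F _ => ?_
    have := (hΘ F).abs_sub_le hab.le (hΘ E) (hm E) (hK E) (δ := |F - E|) fun x => by
      rw [abs_sub_comm F E]; exact (congrArg abs (by ring)).le
    rw [hN, hN, Real.dist_eq, Real.dist_eq, abs_sub_comm]
    linarith
  -- At `E = k² - M` the coefficient `E - W` is at most `k²`, and the explicit angle differs from `k
  -- (b - a)` by an arctangent, hence by less than `π / 2`. The bound `hupp` is symmetric.
  have hlow : ∀ k : ℝ, 0 < k → N (k ^ 2 - M) ≤ k * (b - a) + Real.pi / 2 := fun k hk => by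
    have := (hΘ (k ^ 2 - M)).le_of_le hab.le (isPrufer_sq a b hk) measurable_const
      (K := |k ^ 2|) (fun _ => le_rfl) (fun x => by linarith [(abs_le.1 (hM x)).1])
      (Set.right_mem_Icc.2 hab.le)
    rw [hN]
    exact this.trans (add_le_add_right (Real.arctan_lt_pi_div_two _).le _)
  have hupp : ∀ k : ℝ, 0 < k → k * (b - a) - Real.pi / 2 ≤ N (k ^ 2 + M) := fun k hk => by
    have := (isPrufer_sq a b hk).le_of_le hab.le (hΘ (k ^ 2 + M)) (hm _) (hK _)
      (fun x => by linarith [(abs_le.1 (hM x)).2]) (Set.right_mem_Icc.2 hab.le)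
    rw [hN]
    refine le_trans ?_ this
    rw [sub_eq_add_neg]
    exact add_le_add_right (Real.neg_pi_div_two_lt_arctan _).le _
  have hzero : N (-M) ≤ Real.pi / 2 := by
    have := (hΘ (-M)).le_of_le hab.le (isPrufer_zero a b) measurable_const (K := |0|)
      (fun _ => le_rfl) (fun x => by linarith [(abs_le.1 (hM x)).1]) (Set.right_mem_Icc.2 hab.le)
    rw [hN]
    exact this.trans (Real.arctan_lt_pi_div_two _).le
  -- The halves in `k + 3/2` and `k + 1/2` absorb the error `π / 2`.
  have hupp' : ∀ k : ℕ, (k + 1) * Real.pi ≤ N ((Real.pi / (b - a) * (k + 3 / 2)) ^ 2 + M) :=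
    fun k => by
      refine le_trans (le_of_eq ?_) (hupp (Real.pi / (b - a) * (k + 3 / 2)) (by positivity))
      field_simp; ring
  have hlow' : ∀ k : ℕ, N ((Real.pi / (b - a) * (k + 1 / 2)) ^ 2 - M) ≤ (k + 1) * Real.pi :=
    fun k => by
      refine (hlow (Real.pi / (b - a) * (k + 1 / 2)) (by positivity)).trans (le_of_eq ?_)
      field_simp; ring
  -- Intermediate value theorem: since `k` starts at `0`, level `k` is where the angle reaches `(k +
  -- 1) π`. The lower point `-M` serves every `k`.
  choose e he using fun k : ℕ => mem_range_of_exists_le_of_exists_ge hcont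
    (c := (k + 1) * Real.pi) ⟨-M, hzero.trans (by
      have : 0 ≤ k * Real.pi := by positivity
      linarith)⟩ ⟨_, hupp' k⟩
  refine ⟨e, fun i j hij => hmono.lt_iff_lt.1 ?_, ?_, fun k => ⟨hmono.le_iff_le.1 ?_,
    hmono.le_iff_le.1 ?_⟩⟩
  · rw [he, he]
    gcongr
  · ext E
    rw [mem_eigenvalueSet_iff hab hW hM (hΘ E), ← hN, Real.sin_eq_zero_iff]
    constructor
    · rintro ⟨k, rfl⟩
      exact ⟨k + 1, by rw [he]; push_cast; ring⟩
    · rintro ⟨n, hn⟩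
      have h1 := hpos E
      rw [← hn] at h1
      have h2 : 0 < n := by exact_mod_cast pos_of_mul_pos_left h1 hpi.le
      obtain ⟨k, rfl⟩ : ∃ k : ℕ, n = k + 1 := ⟨(n - 1).toNat, by omega⟩
      refine ⟨k, hmono.injective ?_⟩
      rw [he, ← hn]
      push_cast; ring
  · rw [he]; exact hlow' k
  · rw [he]; exact hupp' k

/-! ### Asymptotics of the sum of logarithms. -/

theorem sum_sq_add_two_le (N : ℕ) :
    ∑ k ∈ Finset.range N, ((k : ℝ) + 2) ^ 2 ≤ ((N : ℝ) + 2) ^ 3 / 3 := by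
  induction N with
  | zero => norm_num
  | succ n ih =>
    rw [Finset.sum_range_succ]
    push_cast
    have : (0 : ℝ) ≤ n := n.cast_nonneg
    nlinarith

theorem le_sum_sq (N : ℕ) : (N : ℝ) ^ 3 / 3 - (N : ℝ) ^ 2 / 2 ≤ ∑ k ∈ Finset.range N, (k : ℝ) ^ 2 := by
  induction N with
  | zero => norm_num
  | succ n ih =>
    rw [Finset.sum_range_succ]
    push_cast
    have : (0 : ℝ) ≤ n := n.cast_nonneg
    nlinarith

theorem le_log_one_add_exp (x : ℝ) : x ≤ Real.log (1 + Real.exp x) := by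
  rw [Real.le_log_iff_exp_le (by positivity)]
  linarith

theorem log_one_add_exp_le {x : ℝ} (hx : 0 ≤ x) : Real.log (1 + Real.exp x) ≤ x + 1 := by
  rw [Real.log_le_iff_le_exp (by positivity), Real.exp_add]
  have h1 := Real.one_le_exp hx
  have h2 := Real.add_one_le_exp (1 : ℝ)
  nlinarith

theorem log_one_add_exp_le_exp (x : ℝ) : Real.log (1 + Real.exp x) ≤ Real.exp x := by
  have := Real.log_le_sub_one_of_pos (show 0 < 1 + Real.exp x by positivity)
  linarith

section

variable {e : ℕ → ℝ} {c β M : ℝ}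

theorem exp_neg_sq_le (hβ : 0 < β) (c : ℝ) (k : ℕ) :
    Real.exp (-(β * c ^ 2 * (k : ℝ) ^ 2)) ≤ Real.exp (-(β * c ^ 2)) ^ k := by
  rw [← Real.exp_nat_mul, Real.exp_le_exp]
  have h1 : (k : ℝ) ≤ (k : ℝ) ^ 2 := by exact_mod_cast Nat.le_self_pow two_ne_zero k
  have h2 : 0 ≤ β * c ^ 2 := by positivity
  nlinarith

theorem summable_exp_pow (hβ : 0 < β) (hc : 0 < c) :
    Summable fun k : ℕ => Real.exp (-(β * c ^ 2)) ^ k :=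
  summable_geometric_of_lt_one (Real.exp_pos _).le (by
    rw [Real.exp_lt_one_iff]
    have : 0 < β * c ^ 2 := by positivity
    linarith)

/-- Since `k ≤ k²`, the Gaussian decay is dominated by a geometric series. -/
theorem summable_boltzmann (hβ : 0 < β) (hc : 0 < c) (he : ∀ k : ℕ, (c * k) ^ 2 - M ≤ e k)
    (μ : ℝ) : Summable fun k => Real.exp (β * (μ - e k)) := by
  refine Summable.of_nonneg_of_le (fun k => (Real.exp_pos _).le) (fun k => ?_)
    ((summable_exp_pow hβ hc).mul_left (Real.exp (β * (μ + M))))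
  refine le_trans ?_ (mul_le_mul_of_nonneg_left (exp_neg_sq_le hβ c k) (Real.exp_pos _).le)
  rw [← Real.exp_add, Real.exp_le_exp]
  have := mul_le_mul_of_nonneg_left (he k) hβ.le
  linarith

theorem log_tprod_eq_tsum (hβ : 0 < β) (hc : 0 < c) (he : ∀ k : ℕ, (c * k) ^ 2 - M ≤ e k)
    (μ : ℝ) : Summable (fun k => Real.log (1 + Real.exp (β * (μ - e k)))) ∧
      Real.log (∏' k, (1 + Real.exp (β * (μ - e k)))) =
        ∑' k, Real.log (1 + Real.exp (β * (μ - e k))) := by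
  have h := Real.summable_log_one_add_of_summable (summable_boltzmann hβ hc he μ)
  refine ⟨h, ?_⟩
  rw [← Real.rexp_tsum_eq_tprod (fun k => by positivity) h, Real.log_exp]

/-- Here `y` is the Fermi momentum in units of `c`. All summands are nonnegative, so only the levels
`k < ⌊y⌋₊` are kept, each bounded below by its exponent. -/
theorem tsum_log_ge (hβ : 0 < β) (hc : 0 < c) (he : ∀ k : ℕ, (c * k) ^ 2 - M ≤ e k)
    (he' : ∀ k : ℕ, e k ≤ (c * (k + 2)) ^ 2 + M) {μ y : ℝ} (hy : 0 ≤ y)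
    (hμ : μ - M = c ^ 2 * y ^ 2) :
    β * c ^ 2 * ((y - 1) * y ^ 2 - (y + 2) ^ 3 / 3) ≤
      ∑' k, Real.log (1 + Real.exp (β * (μ - e k))) := by
  have hs := (log_tprod_eq_tsum hβ hc he μ).1
  refine le_trans ?_ (hs.sum_le_tsum (Finset.range ⌊y⌋₊) fun k _ =>
    Real.log_nonneg (by linarith [Real.exp_pos (β * (μ - e k))]))
  -- The last terms on the left may be negative; `x ≤ log (1 + e^x)` holds for every sign of `x`.
  have h1 : ∑ k ∈ Finset.range ⌊y⌋₊, β * c ^ 2 * (y ^ 2 - ((k : ℝ) + 2) ^ 2) ≤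
      ∑ k ∈ Finset.range ⌊y⌋₊, Real.log (1 + Real.exp (β * (μ - e k))) := by
    refine Finset.sum_le_sum fun k _ => le_trans ?_ (le_log_one_add_exp _)
    have := mul_le_mul_of_nonneg_left (he' k) hβ.le
    have h2 : β * (μ - M) = β * (c ^ 2 * y ^ 2) := by rw [hμ]
    linarith
  refine le_trans ?_ h1
  rw [← Finset.mul_sum, Finset.sum_sub_distrib, Finset.sum_const, Finset.card_range,
    nsmul_eq_mul]
  have h2 := sum_sq_add_two_le ⌊y⌋₊
  have h3 := Nat.floor_le hy
  have h4 := Nat.lt_floor_add_one y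
  have h5 : ((⌊y⌋₊ : ℝ) + 2) ^ 3 ≤ (y + 2) ^ 3 := by gcongr
  have h6 : (y - 1) * y ^ 2 ≤ ⌊y⌋₊ * y ^ 2 := by gcongr; linarith
  gcongr
  linarith

/-- The sum is split at the Fermi level. Below it each logarithm exceeds the bound `β c² (y² - k²)`
on its exponent by at most `1`; above it the terms are dominated by a geometric series independent
of `μ`. -/
theorem tsum_log_le (hβ : 0 < β) (hc : 0 < c) (he : ∀ k : ℕ, (c * k) ^ 2 - M ≤ e k)
    {μ y : ℝ} (hy : 0 ≤ y) (hμ : μ + M = c ^ 2 * y ^ 2) :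
    ∑' k, Real.log (1 + Real.exp (β * (μ - e k))) ≤
      β * c ^ 2 * ((y + 1) * y ^ 2 - y ^ 3 / 3 + (y + 1) ^ 2 / 2) + (y + 1) +
        ∑' k : ℕ, Real.exp (-(β * c ^ 2)) ^ k := by
  have hs := (log_tprod_eq_tsum hβ hc he μ).1
  obtain ⟨N, hN⟩ : ∃ N, N = ⌈y⌉₊ := ⟨_, rfl⟩
  have h3 : y ≤ N := hN ▸ Nat.le_ceil y
  have h4 : (N : ℝ) < y + 1 := hN ▸ Nat.ceil_lt_add_one hy
  have hx : ∀ k : ℕ, β * (μ - e k) ≤ β * c ^ 2 * (y ^ 2 - (k : ℝ) ^ 2) := fun k => by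
    have := mul_le_mul_of_nonneg_left (he k) hβ.le
    have h2 : β * (μ + M) = β * (c ^ 2 * y ^ 2) := by rw [hμ]
    linarith
  have head : ∑ k ∈ Finset.range N, Real.log (1 + Real.exp (β * (μ - e k))) ≤
      β * c ^ 2 * ((y + 1) * y ^ 2 - y ^ 3 / 3 + (y + 1) ^ 2 / 2) + (y + 1) := by
    have h1 : ∑ k ∈ Finset.range N, Real.log (1 + Real.exp (β * (μ - e k))) ≤
        ∑ k ∈ Finset.range N, (β * c ^ 2 * (y ^ 2 - (k : ℝ) ^ 2) + 1) := by
      refine Finset.sum_le_sum fun k hk => ?_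
      have hk1 : (k : ℝ) ≤ y := (Nat.lt_ceil.1 (hN ▸ Finset.mem_range.1 hk)).le
      have h0 : 0 ≤ β * c ^ 2 * (y ^ 2 - (k : ℝ) ^ 2) := by
        have : (k : ℝ) ^ 2 ≤ y ^ 2 := by gcongr
        have h5 : 0 ≤ y ^ 2 - (k : ℝ) ^ 2 := sub_nonneg.2 this
        positivity
      refine le_trans (Real.log_le_log (by positivity) ?_) (log_one_add_exp_le h0)
      exact add_le_add_right (Real.exp_le_exp.2 (hx k)) 1
    refine h1.trans ?_
    rw [Finset.sum_add_distrib, ← Finset.mul_sum, Finset.sum_sub_distrib, Finset.sum_const,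
      Finset.sum_const, Finset.card_range, nsmul_eq_mul, nsmul_eq_mul, mul_one]
    have h2 := le_sum_sq N
    have h5 : y ^ 3 ≤ (N : ℝ) ^ 3 := by gcongr
    have h7 : (N : ℝ) ^ 2 ≤ (y + 1) ^ 2 := by gcongr
    have h6 : N * y ^ 2 ≤ (y + 1) * y ^ 2 := by gcongr
    gcongr
    linarith
  have tail : ∀ j : ℕ, Real.log (1 + Real.exp (β * (μ - e (j + N)))) ≤
      Real.exp (-(β * c ^ 2)) ^ j := fun j => by
    refine (log_one_add_exp_le_exp _).trans (le_trans ?_ (exp_neg_sq_le hβ c j))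
    rw [Real.exp_le_exp]
    refine (hx _).trans ?_
    -- From `(j + N)² ≥ j² + N²` and `N ≥ y`.
    have h1 : y ^ 2 + (j : ℝ) ^ 2 ≤ ((j + N : ℕ) : ℝ) ^ 2 := by
      push_cast
      have : (0 : ℝ) ≤ j := j.cast_nonneg
      nlinarith
    have h2 : 0 ≤ β * c ^ 2 := by positivity
    nlinarith
  rw [← hs.sum_add_tsum_nat_add N]
  exact add_le_add head (Summable.tsum_le_tsum tail ((summable_nat_add_iff N).2 hs)
    (summable_exp_pow hβ hc))

theorem tendsto_sqrt_add_div_sqrt (m : ℝ) :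
    Tendsto (fun μ : ℝ => √(μ + m) / √μ) atTop (𝓝 1) := by
  have h1 : Tendsto (fun μ : ℝ => 1 + m * μ⁻¹) atTop (𝓝 (1 + m * 0)) :=
    (tendsto_inv_atTop_zero.const_mul m).const_add 1
  have h2 := (Real.continuous_sqrt.tendsto _).comp h1
  rw [mul_zero, add_zero, Real.sqrt_one] at h2
  refine h2.congr' ?_
  filter_upwards [eventually_gt_atTop 0] with μ hμ
  rw [← Real.sqrt_div' _ hμ.le, Function.comp_apply]
  congr 1
  field_simp

/-- The Weyl type asymptotics of the logarithm of the partition function. -/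
theorem tendsto_tsum_log_div (hβ : 0 < β) (hc : 0 < c) (he : ∀ k : ℕ, (c * k) ^ 2 - M ≤ e k)
    (he' : ∀ k : ℕ, e k ≤ (c * (k + 2)) ^ 2 + M) :
    Tendsto (fun μ : ℝ => (∑' k, Real.log (1 + Real.exp (β * (μ - e k)))) /
      (β * (2 / 3) * (1 / c) * μ ^ (3 / 2 : ℝ))) atTop (𝓝 1) := by
  obtain ⟨D, hD⟩ : ∃ D, D = ∑' k : ℕ, Real.exp (-(β * c ^ 2)) ^ k := ⟨_, rfl⟩
  obtain ⟨A, hA⟩ : ∃ A, A = β * (2 / 3) * (1 / c) := ⟨_, rfl⟩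
  have hA0 : 0 < A := by rw [hA]; positivity
  rw [← hA]
  have hi : Tendsto (fun μ : ℝ => 1 / √μ) atTop (𝓝 0) := by
    simp only [one_div]
    exact tendsto_inv_atTop_zero.comp Real.tendsto_sqrt_atTop
  have ht : ∀ m : ℝ, Tendsto (fun μ : ℝ => (√(μ + m) / √μ / c, 1 / √μ)) atTop (𝓝 (1 / c, 0)) :=
    fun m => ((tendsto_sqrt_add_div_sqrt m).div_const c).prodMk_nhds hi
  have hlim : ∀ (m : ℝ) (F : ℝ × ℝ → ℝ), Continuous F → F (1 / c, 0) = A →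
      Tendsto (fun μ : ℝ => F (√(μ + m) / √μ / c, 1 / √μ) / A) atTop (𝓝 1) := fun m F hF hF0 => by
    have := ((hF.tendsto _).comp (ht m)).div_const A
    rwa [hF0, div_self hA0.ne'] at this
  -- Divided by `√μ ^ 3`, both bounds become continuous functions of `(y / √μ, 1 / √μ)`, which tends
  -- to `(1 / c, 0)`; there the value is `β c² (1 - 1/3) / c³ = A`.
  have hlo := hlim (-M) (fun p => β * c ^ 2 * ((p.1 - p.2) * p.1 ^ 2 - (p.1 + 2 * p.2) ^ 3 / 3))
    (by fun_prop) (by simp only [hA]; field_simp; ring)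
  have hup := hlim M (fun p => β * c ^ 2 * ((p.1 + p.2) * p.1 ^ 2 - p.1 ^ 3 / 3 +
        (p.1 + p.2) ^ 2 * p.2 / 2) +
      (p.1 + p.2) * p.2 ^ 2 + D * p.2 ^ 3)
    (by fun_prop) (by simp only [hA]; field_simp; ring)
  have hpow : ∀ μ : ℝ, 0 < μ → μ ^ (3 / 2 : ℝ) = √μ ^ 3 := fun μ hμ => by
    rw [Real.sqrt_eq_rpow, ← Real.rpow_natCast, ← Real.rpow_mul hμ.le]
    norm_num
  refine tendsto_of_tendsto_of_tendsto_of_le_of_le' hlo hup ?_ ?_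
  · filter_upwards [eventually_gt_atTop 0, eventually_ge_atTop M] with μ hμ hM
    have h := tsum_log_ge hβ hc he he' (y := √(μ + -M) / c) (μ := μ) (by positivity) (by
      rw [div_pow, Real.sq_sqrt (by linarith)]; field_simp; ring)
    have hs : 0 < √μ := Real.sqrt_pos.2 hμ
    rw [hpow μ hμ, mul_comm A, ← div_div]
    refine div_le_div_of_nonneg_right ?_ hA0.le
    rw [le_div_iff₀ (by positivity)]
    refine le_trans (le_of_eq ?_) h
    field_simp
  · filter_upwards [eventually_gt_atTop 0, eventually_ge_atTop (-M)] with μ hμ hM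
    have h := tsum_log_le hβ hc he (y := √(μ + M) / c) (μ := μ) (by positivity) (by
      rw [div_pow, Real.sq_sqrt (by linarith)]; field_simp)
    rw [← hD] at h
    have hs : 0 < √μ := Real.sqrt_pos.2 hμ
    rw [hpow μ hμ, mul_comm A, ← div_div]
    refine div_le_div_of_nonneg_right ?_ hA0.le
    rw [div_le_iff₀ (by positivity)]
    refine h.trans (le_of_eq ?_)
    field_simp

end

/-! ### Passage to essentially bounded potentials, and conclusion. -/

theorem hamiltonian_congr {a b : ℝ} {V W : ℝ → ℝ}
    (h : V =ᵐ[(volume : Measure ℝ).restrict (Set.Icc a b)] W) :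
    hamiltonian a b V = hamiltonian a b W := by
  have : hamiltonianGraph a b V = hamiltonianGraph a b W := by
    ext p
    refine exists_congr fun w => and_congr_right fun _ => eventually_congr ?_
    filter_upwards [h] with x hx
    rw [hx]
  rw [hamiltonian, this, hamiltonian]

theorem eigenspace_congr {a b : ℝ} {V W : ℝ → ℝ}
    (h : V =ᵐ[(volume : Measure ℝ).restrict (Set.Icc a b)] W) :
    eigenspace a b V = eigenspace a b W := by
  funext E
  ext f
  change (f, (E : ℂ) • f) ∈ (hamiltonian a b V).graph ↔ (f, (E : ℂ) • f) ∈ (hamiltonian a b W).graph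
  rw [hamiltonian_congr h]

/-- The Prüfer comparison needs pointwise bounds and measurability. Truncating a measurable
representative at the essential supremum provides both and, by `hamiltonian_congr`, leaves the
operator unchanged. -/
theorem exists_measurable_bounded {a b : ℝ} {V : ℝ → ℝ}
    (hV : MemLp V ∞ ((volume : Measure ℝ).restrict (Set.Icc a b))) :
    ∃ (W : ℝ → ℝ) (M : ℝ), Measurable W ∧ (∀ x, |W x| ≤ M) ∧
      V =ᵐ[(volume : Measure ℝ).restrict (Set.Icc a b)] W := by
  obtain ⟨M, hM0, hM⟩ : ∃ M : ℝ, 0 ≤ M ∧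
      ∀ᵐ x ∂((volume : Measure ℝ).restrict (Set.Icc a b)), |V x| ≤ M := by
    refine ⟨(eLpNorm V ∞ ((volume : Measure ℝ).restrict (Set.Icc a b))).toReal,
      ENNReal.toReal_nonneg, ?_⟩
    filter_upwards [ae_le_eLpNormEssSup (f := V)
      (μ := (volume : Measure ℝ).restrict (Set.Icc a b))] with x hx
    rw [← eLpNorm_exponent_top] at hx
    have := ENNReal.toReal_mono hV.2.ne hx
    rwa [toReal_enorm] at this
  refine ⟨fun x => max (-M) (min M (hV.1.mk V x)), M, ?_, fun x => ?_, ?_⟩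
  · have := hV.1.stronglyMeasurable_mk.measurable
    fun_prop
  · exact abs_le.2 ⟨le_max_left _ _, max_le (by linarith) (min_le_left _ _)⟩
  · filter_upwards [hM, hV.1.ae_eq_mk] with x h1 h2
    rw [← h2, min_eq_right (abs_le.1 h1).2, max_eq_right (abs_le.1 h1).1]

theorem spectrum_and_asymptotics {a b β : ℝ} (hab : a < b) (hβ : 0 < β) {V : ℝ → ℝ}
    (hV : MemLp V ∞ ((volume : Measure ℝ).restrict (Set.Icc a b))) :
    (StrictMono (energy a b V) ∧ Set.range (energy a b V) = eigenvalueSet a b V) ∧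
    (∀ k, Module.finrank ℂ (eigenspace a b V (energy a b V k)) = 1) ∧
    (∀ μ : ℝ, Multipliable (grandFactor a b β V μ)) ∧
    Tendsto (fun μ : ℝ => Real.log (grandPartition a b β V μ) /
      (β * (2 / 3) * ((b - a) / Real.pi) * μ ^ (3 / 2 : ℝ))) atTop (𝓝 1) := by
  obtain ⟨W, M, hW, hM, hVW⟩ := exists_measurable_bounded hV
  have hsp := eigenspace_congr hVW
  have hset : eigenvalueSet a b V = eigenvalueSet a b W := by rw [eigenvalueSet, hsp, eigenvalueSet]
  obtain ⟨e, he, hr, hbd⟩ := exists_eigenvalue_enumeration hab hW hM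
  have hen : energy a b V = e := by
    funext k
    rw [energy, hset, ← hr, sInf_encard_eq he]
  have hc : 0 < Real.pi / (b - a) := div_pos Real.pi_pos (sub_pos.2 hab)
  have hlo : ∀ k : ℕ, (Real.pi / (b - a) * k) ^ 2 - M ≤ e k := fun k => by
    refine le_trans ?_ (hbd k).1
    gcongr
    linarith
  have hup : ∀ k : ℕ, e k ≤ (Real.pi / (b - a) * (k + 2)) ^ 2 + M := fun k => by
    refine (hbd k).2.trans ?_
    gcongr
    norm_num
  have hfac : ∀ μ k, grandFactor a b β V μ k = 1 + Real.exp (β * (μ - e k)) := fun μ k => by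
    rw [grandFactor, hen, ← Real.exp_add]
    congr 2
    ring
  refine ⟨⟨hen ▸ he, by rw [hen, hr, hset]⟩, fun k => ?_, fun μ => ?_, ?_⟩
  · rw [hsp, hen]
    exact finrank_eigenspace hab hW hM (hr ▸ Set.mem_range_self k)
  · rw [funext (hfac μ)]
    exact Real.multipliable_one_add_of_summable (summable_boltzmann hβ hc hlo μ)
  · refine (tendsto_tsum_log_div hβ hc hlo hup).congr fun μ => ?_
    rw [grandPartition, funext (hfac μ), (log_tprod_eq_tsum hβ hc hlo μ).2, one_div_div]

end FermiGas

theorem theorem2 (a b β : ℝ) (hab : a < b) (hβ : 0 < β) (V : ℝ → ℝ)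
    (hV : MemLp V ∞ ((volume : Measure ℝ).restrict (Set.Icc a b))) :
    (StrictMono (FermiGas.energy a b V) ∧
      Set.range (FermiGas.energy a b V) = FermiGas.eigenvalueSet a b V) ∧
    (∀ k, Module.finrank ℂ (FermiGas.eigenspace a b V (FermiGas.energy a b V k)) = 1) ∧
    (∀ μ : ℝ, Multipliable (FermiGas.grandFactor a b β V μ)) ∧
    Tendsto (fun μ : ℝ => Real.log (FermiGas.grandPartition a b β V μ) /
      Real.log (FermiGas.grandPartition a b β 0 μ)) atTop (𝓝 1) ∧
    (fun μ : ℝ => Real.log (FermiGas.grandPartition a b β V μ)) ~[atTop]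
      (fun μ : ℝ => β * (2 / 3) * ((b - a) / Real.pi) * μ ^ (3 / 2 : ℝ)) ∧
    (fun μ : ℝ => Real.log (FermiGas.grandPartition a b β 0 μ)) ~[atTop]
      (fun μ : ℝ => β * (2 / 3) * ((b - a) / Real.pi) * μ ^ (3 / 2 : ℝ)) := by
  obtain ⟨h1, h2, h3, hA⟩ := FermiGas.spectrum_and_asymptotics hab hβ hV
  obtain ⟨-, -, -, hB⟩ := FermiGas.spectrum_and_asymptotics hab hβ (V := 0) MemLp.zero
  have hne : ∀ᶠ μ : ℝ in atTop, β * (2 / 3) * ((b - a) / Real.pi) * μ ^ (3 / 2 : ℝ) ≠ 0 := by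
    filter_upwards [eventually_gt_atTop 0] with μ hμ
    have := Real.pi_pos
    have := sub_pos.2 hab
    positivity
  refine ⟨h1, h2, h3, ?_, (isEquivalent_iff_tendsto_one hne).2 hA,
    (isEquivalent_iff_tendsto_one hne).2 hB⟩
  -- Both logarithms have the same leading term, which cancels in the quotient.
  have h := hA.div hB one_ne_zero
  rw [div_one] at h
  refine h.congr' ?_
  filter_upwards [hne] with μ hμ
  simp only [Pi.div_apply]
  exact div_div_div_cancel_right₀ hμ _ _
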